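/- Let $\mathbb T=\mathbb R/2\pi\mathbb Z$ and, for $\nu>0$, consider the equation $$\partial_t h=\partial_x\big((\partial_x h)^3-\partial_x h\big)-\nu\,\partial_x^4h\qquad\text{on }[0,\infty)\times\mathbb T .\tag{1}$$ A global solution of (1) with initial datum $h_0$ is a function $h$ with $h(0)=h_0$, $h\in C([0,\infty);H^{1/2}(\mathbb T))$, $t^{1/4}\partial_xh\in C([0,\infty);C(\mathbb T))$, $t^{1/4}h\in C([0,\infty);H^{3/2}(\mathbb T))$, and $$h(t)=e^{-\nu t\partial_x^4}h_0+\int_0^t\partial_xe^{-\nu(t-s)\partial_x^4}\big(((\partial_xh)^2-1)\partial_xh\big)(s)\,ds\qquad(t\ge0).$$ For $h_0\in H^2(\mathbb T)$ put $$E_0=E_0(\nu,h_0)=\int_{\mathbb T}\Big(\tfrac12\nu|\partial_{xx}h_0|^2+\tfrac14\big(|\partial_xh_0|^2-1\big)^2\Big)dx .$$ Proposition 5.1. Fix $\nu_0>0$ (for instance $\nu_0=1$). (i) There is a constant $C_1>0$ such that for all $0<\nu\le\nu_0$ and all $h_0\in H^2(\mathbb T)$ with mean zero, the corresponding global solution $h$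 of (1) satisfies $$\|\partial_xh(t)\|_{L^\infty(\mathbb T)}\le C_1\max\{1,\nu^{-1/6}E_0^{1/3}\}\qquad\text{for all }t\ge0 .$$ (ii) There are constants $C_2,B_1>0$ such that for each $0<\nu\le\nu_0$ there is a nonempty family $\mathcal A_\nu$ of mean-zero initial data in $H^2(\mathbb T)$ such that every $h_0\in\mathcal A_\nu$ satisfies $E_0\le C_2\sqrt\nu$, and the corresponding global solution $h$ of (1) satisfies $$\|\partial_xh(t)\|_{L^\infty(\mathbb T)}\le B_1\qquad\text{for all }t\ge0 .$$ The constants $C_1,C_2,B_1$ do not depend on $\nu$, $h_0$ or $t$. -/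

import Mathlib

open MeasureTheory Filter Topology
open scoped ENNReal

noncomputable section

namespace ThinFilm

/-- The `2π`-periodic torus `𝕋 = ℝ / 2πℤ`.  Its `volume` is Lebesgue measure, of total mass `2π`. -/
abbrev Torus : Type := AddCircle (2 * Real.pi)

instance fact_two_pi_pos : Fact (0 < 2 * Real.pi) := ⟨Real.two_pi_pos⟩

/-- Fourier coefficients of a real function on the torus (with respect to the normalised measure
`dx / 2π`), `f̂(k) = (2π)⁻¹ ∫ f(x) e^{-ikx} dx`. -/
def coeff (f : Torus → ℝ) (k : ℤ) : ℂ := fourierCoeff (fun x => (f x : ℂ)) k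

/-- The squared Sobolev norm `∑ₖ (1 + |k|^{2s}) |f̂(k)|²`, with values in `[0, ∞]`. -/
def hsNormSq (s : ℝ) (f : Torus → ℝ) : ℝ≥0∞ :=
  ∑' k : ℤ, ENNReal.ofReal ((1 + |(k : ℝ)| ^ (2 * s)) * ‖coeff f k‖ ^ 2)

/-- Membership in the Sobolev space `H^s(𝕋)`, for `s ≥ 0`. -/
def MemHs (s : ℝ) (f : Torus → ℝ) : Prop := MemLp f 2 volume ∧ hsNormSq s f < ∞

/-- `u ∈ C([0, ∞); H^s(𝕋))`. -/
def ContinuousInHs (s : ℝ) (u : ℝ → Torus → ℝ) : Prop :=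
  (∀ t, 0 ≤ t → MemHs s (u t)) ∧
    ∀ t₀, 0 ≤ t₀ →
      Tendsto (fun t => hsNormSq s (fun x => u t x - u t₀ x)) (𝓝[Set.Ici 0] t₀) (𝓝 0)

/-- `v ∈ C([0, ∞); C(𝕋))`, where each `v t` is given up to a null set and `C(𝕋)` has the sup
norm. -/
def ContinuousInC (v : ℝ → Torus → ℝ) : Prop :=
  ∃ w : ℝ → C(Torus, ℝ), ContinuousOn w (Set.Ici 0) ∧ ∀ t, 0 ≤ t → v t =ᵐ[volume] w t

/-- `g` is the weak (distributional) derivative of `f` on the torus: `ĝ(k) = i k f̂(k)` for all `k`,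
that is, `∫ g φ = - ∫ f φ'` for the test functions `φ(x) = e^{-ikx}`. -/
def IsWeakDeriv (f g : Torus → ℝ) : Prop :=
  Integrable g volume ∧ ∀ k : ℤ, coeff g k = Complex.I * k * coeff f k

open Classical in
/-- The weak derivative `∂ₓ f`, an integrable function determined up to a null set; it is `0` by
convention if `f` has no integrable weak derivative (it has one as soon as `f ∈ H¹(𝕋)`). -/
def dx (f : Torus → ℝ) : Torus → ℝ :=
  if hf : ∃ g, IsWeakDeriv f g then hf.choose else fun _ => 0

/-- The energy `E(f) = ∫ (ν/2 |∂ₓₓ f|² + 1/4 (|∂ₓ f|² - 1)²) dx`. -/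
def energy (ν : ℝ) (f : Torus → ℝ) : ℝ :=
  ∫ x : Torus, (1 / 2 * ν * (dx (dx f) x) ^ 2 + 1 / 4 * ((dx f x) ^ 2 - 1) ^ 2)

/-- The nonlinearity `(fₓ² - 1) fₓ = fₓ³ - fₓ`. -/
def flux (f : Torus → ℝ) : Torus → ℝ := fun x => ((dx f x) ^ 2 - 1) * dx f x

/-- `h` is a global (mild) solution of `h_t = (h_x³ - h_x)_x - ν h_xxxx` on `[0, ∞) × 𝕋` with initial
datum `h₀`: it belongs to `C([0, ∞); H^{1/2})`, `t^{1/4} ∂ₓ h` to `C([0, ∞); C(𝕋))` and `t^{1/4} h`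
to `C([0, ∞); H^{3/2})`, and
`h(t) = e^{-νt∂ₓ⁴} h₀ + ∫₀ᵗ ∂ₓ e^{-ν(t-s)∂ₓ⁴} ((h_x² - 1) h_x)(s) ds`,
which is written out for each Fourier coefficient. -/
structure IsGlobalSolution (ν : ℝ) (h₀ : Torus → ℝ) (h : ℝ → Torus → ℝ) : Prop where
  initial : h 0 =ᵐ[volume] h₀
  continuous_half : ContinuousInHs (1 / 2) h
  continuous_grad : ContinuousInC (fun t x => t ^ (1 / 4 : ℝ) * dx (h t) x)
  continuous_three_halves : ContinuousInHs (3 / 2) (fun t x => t ^ (1 / 4 : ℝ) * h t x)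
  duhamel : ∀ t, 0 ≤ t → ∀ k : ℤ,
    coeff (h t) k = (Real.exp (-(ν * t * (k : ℝ) ^ 4)) : ℂ) * coeff h₀ k +
      ∫ s in (0 : ℝ)..t, Complex.I * k * (Real.exp (-(ν * (t - s) * (k : ℝ) ^ 4)) : ℂ) *
        coeff (flux (h s)) k

/-- The initial data: functions in `H²(𝕋)` with mean zero. -/
def IsDatum (h₀ : Torus → ℝ) : Prop := MemHs 2 h₀ ∧ ∫ x : Torus, h₀ x = 0

/-- The norm `‖∂ₓ f‖_∞` in `L^∞(𝕋)`. -/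
def gradSup (f : Torus → ℝ) : ℝ≥0∞ := eLpNorm (dx f) ∞ volume

end ThinFilm

end

noncomputable section

namespace ThinFilm

/-! ### Fourier coefficients on the circle: Parseval, uniqueness, Riesz–Fischer. -/

open AddCircle ComplexConjugate

/-! Everything follows from the energy. Let `u` be the slope of an `H²` function. It is continuous
with mean zero, so it vanishes somewhere. By the Modica–Mortola inequality, `√(ν/2) |(u² - 1) uₓ| ≤
ν/2 uₓ² + 1/4 (u² - 1)²`. Integrating from a zero of `u` gives `√(ν/2) |u³/3 - u| ≤ E`. For large
`|u|` the cube dominates, whence `|u| ≤ 3 max(1, ν^{-1/6} E^{1/3})`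
(`MemHs.exists_dx_ae_eq_cubic_le`, `MemHs.gradSup_le`).

It remains to see that the energy never exceeds its initial value (`IsGlobalSolution.energy_le`).
The solution class gives continuity at time `0` only in `H^{1/2}`, so the energy is not
differentiated. The equation is the `L²` gradient flow of `E`, and `E` is semiconvex: the concave
part of the double well costs `1/2 ‖∂ₓ(f - v)‖²`, which the bending term and `‖f - v‖²/(8ν)` absorb
(`tsum_conj_mul_le`). Take `v = h(a)` and `y(s) = ‖h(s) - h(a)‖²`. If `E(h(s)) > E(h(a))` on all of
`(a, b]`, then `e^{-s/(4ν)} y(s)` would strictly decrease from `0`, although `y ≥ 0`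
(`IsGlobalSolution.exists_energy_le`). Continuity of the energy at positive times turns this into
monotonicity from time `0`. The regularity needed comes from Duhamel's formula, which gives
coefficients of order `|k|^{-3}` at positive times (`IsGlobalSolution.norm_coeff_le`).

For the second part, a sawtooth with slope close to `±1` and corners of width `√ν` has energy
`O(√ν)` (`exists_isDatum_energy_le`). On data of such energy the first bound no longer depends on
`ν`. -/

lemma integral_torus (f : Torus → ℝ) :
    ∫ x, f x = 2 * Real.pi * ∫ x, f x ∂haarAddCircle := by
  rw [integral_haarAddCircle, smul_eq_mul, mul_inv_cancel_left₀ Real.two_pi_pos.ne']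

lemma integrable_ofReal_haar {f : Torus → ℝ} (hf : Integrable f volume) :
    Integrable (fun x => (f x : ℂ)) (haarAddCircle : Measure Torus) := by
  have h : MemLp (fun x => (f x : ℂ)) 1 (volume : Measure Torus) :=
    memLp_one_iff_integrable.2 hf.ofReal
  exact memLp_one_iff_integrable.1 h.haarAddCircle

lemma memLp_ofReal_haar {f : Torus → ℝ} {p : ℝ≥0∞} (hf : MemLp f p volume) :
    MemLp (fun x => (f x : ℂ)) p (haarAddCircle : Measure Torus) :=
  MemLp.haarAddCircle hf.ofReal

lemma ae_haar {p : Torus → Prop} (h : ∀ᵐ x, p x) : ∀ᵐ x ∂(haarAddCircle : Measure Torus), p x := by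
  have := volume_eq_smul_haarAddCircle (T := 2 * Real.pi)
  rw [this] at h
  exact (Measure.ae_ennreal_smul_measure_iff (by simpa using Real.pi_pos)).1 h

lemma coeff_congr_ae {f g : Torus → ℝ} (h : f =ᵐ[volume] g) (k : ℤ) : coeff f k = coeff g k := by
  refine congrFun (fourierCoeff_congr_ae ?_) k
  filter_upwards [ae_haar h] with x hx
  rw [hx]

lemma coeff_add {f g : Torus → ℝ} (hf : Integrable f volume) (hg : Integrable g volume) (k : ℤ) :
    coeff (fun x => f x + g x) k = coeff f k + coeff g k := by
  have := congrFun (fourierCoeff.add (integrable_ofReal_haar hf) (integrable_ofReal_haar hg)) k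
  simp only [Pi.add_apply] at this
  rw [coeff, coeff, coeff, ← this]
  congr 1
  ext x
  simp

lemma coeff_const_mul (c : ℝ) (f : Torus → ℝ) (k : ℤ) :
    coeff (fun x => c * f x) k = c * coeff f k := by
  rw [coeff, coeff, ← fourierCoeff.const_mul]
  simp

lemma coeff_sub {f g : Torus → ℝ} (hf : Integrable f volume) (hg : Integrable g volume) (k : ℤ) :
    coeff (fun x => f x - g x) k = coeff f k - coeff g k := by
  have h := coeff_add hf (hg.const_mul (-1)) k
  rw [coeff_const_mul] at h
  simpa [sub_eq_add_neg] using h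

lemma norm_coeff_le (f : Torus → ℝ) (k : ℤ) :
    ‖coeff f k‖ ≤ ∫ x, |f x| ∂(haarAddCircle : Measure Torus) := by
  refine (norm_integral_le_integral_norm _).trans_eq ?_
  refine integral_congr_ae (.of_forall fun x => ?_)
  simp only [fourier_apply, smul_eq_mul, norm_mul, Circle.norm_coe, one_mul, Complex.norm_real,
    Real.norm_eq_abs]

lemma coeff_neg_index (f : Torus → ℝ) (k : ℤ) : coeff f (-k) = conj (coeff f k) := by
  rw [coeff, coeff, fourierCoeff, fourierCoeff, ← integral_conj]
  refine integral_congr_ae (.of_forall fun x => ?_)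
  simp only [smul_eq_mul, map_mul, Complex.conj_ofReal, ← fourier_neg]

lemma fourierCoeff_toLp_ofReal {f : Torus → ℝ} (hf : MemLp f 2 volume) (k : ℤ) :
    fourierCoeff ((memLp_ofReal_haar hf).toLp) k = coeff f k :=
  congrFun (fourierCoeff_congr_ae (memLp_ofReal_haar hf).coeFn_toLp) k

/-- Parseval's identity for a pair of real square integrable functions on the torus. -/
lemma hasSum_conj_coeff_mul_coeff {f g : Torus → ℝ} (hf : MemLp f 2 volume)
    (hg : MemLp g 2 volume) :
    HasSum (fun k => (conj (coeff f k) * coeff g k).re)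
      ((2 * Real.pi)⁻¹ * ∫ x, f x * g x) := by
  have h := (fourierBasis (T := 2 * Real.pi)).hasSum_inner_mul_inner
    ((memLp_ofReal_haar hf).toLp) ((memLp_ofReal_haar hg).toLp)
  have h2 := Complex.hasSum_re h
  convert h2 using 1
  · ext k
    rw [← HilbertBasis.repr_apply_apply, ← inner_conj_symm, ← HilbertBasis.repr_apply_apply,
      fourierBasis_repr, fourierBasis_repr, fourierCoeff_toLp_ofReal hf,
      fourierCoeff_toLp_ofReal hg]
  · rw [integral_torus, inv_mul_cancel_left₀ Real.two_pi_pos.ne', L2.inner_def,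
      ← Complex.ofReal_re (∫ x, f x * g x ∂haarAddCircle), ← integral_complex_ofReal]
    congr 1
    refine integral_congr_ae ?_
    filter_upwards [(memLp_ofReal_haar hf).coeFn_toLp, (memLp_ofReal_haar hg).coeFn_toLp]
      with x h1 h2
    rw [h1, h2, RCLike.inner_apply', Complex.conj_ofReal, Complex.ofReal_mul]

lemma hasSum_norm_sq_coeff {f : Torus → ℝ} (hf : MemLp f 2 volume) :
    HasSum (fun k => ‖coeff f k‖ ^ 2) ((2 * Real.pi)⁻¹ * ∫ x, f x ^ 2) := by
  convert hasSum_conj_coeff_mul_coeff hf hf using 3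
  · rw [mul_comm, Complex.mul_conj, Complex.ofReal_re, Complex.normSq_eq_norm_sq]
  · ext; ring

/-- An integrable function on the torus is determined by its Fourier coefficients. -/
lemma ae_eq_of_coeff_eq {f g : Torus → ℝ} (hf : Integrable f volume) (hg : Integrable g volume)
    (h : ∀ k, coeff f k = coeff g k) : f =ᵐ[volume] g := by
  set d : Torus → ℝ := fun x => f x - g x with hd
  have hdi : Integrable d volume := hf.sub hg
  have hdc : ∀ k, coeff d k = 0 := fun k => by rw [coeff_sub hf hg, h, sub_self]
  have hI : Integrable (fun x => (d x : ℂ)) (haarAddCircle : Measure Torus) :=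
    integrable_ofReal_haar hdi
  -- the functional `φ ↦ ∫ φ d` vanishes on trigonometric polynomials, hence on `C(𝕋)`
  have hint : ∀ φ : C(Torus, ℂ), Integrable (fun x => φ x * (d x : ℂ)) haarAddCircle := fun φ =>
    hI.bdd_mul (c := ‖φ‖) φ.continuous.aestronglyMeasurable (.of_forall fun x => φ.norm_coe_le_norm x)
  let Λ : C(Torus, ℂ) →L[ℂ] ℂ := LinearMap.mkContinuous
    { toFun := fun φ => ∫ x, φ x * (d x : ℂ) ∂haarAddCircle
      map_add' := fun φ ψ => by
        simp only [ContinuousMap.add_apply, add_mul]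
        exact integral_add (hint φ) (hint ψ)
      map_smul' := fun c φ => by
        simp only [ContinuousMap.smul_apply, smul_eq_mul, mul_assoc, RingHom.id_apply]
        exact integral_const_mul c _ }
    (∫ x, ‖(d x : ℂ)‖ ∂haarAddCircle) fun φ => by
      refine (norm_integral_le_integral_norm _).trans ?_
      refine le_trans (b := ∫ x, ‖φ‖ * ‖(d x : ℂ)‖ ∂haarAddCircle) ?_
        (by rw [integral_const_mul]; exact (mul_comm _ _).le)
      refine integral_mono_ae (hint φ).norm (hI.norm.const_mul _) (.of_forall fun x => ?_)
      simp only [norm_mul]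
      gcongr
      exact φ.norm_coe_le_norm x
  have hΛ : Λ = 0 := by
    refine ContinuousLinearMap.ext_on (s := Set.range (@fourier (2 * Real.pi))) ?_ ?_
    · exact Submodule.dense_iff_topologicalClosure_eq_top.2 span_fourier_closure_eq_top
    · rintro _ ⟨n, rfl⟩
      have := hdc (-n)
      rw [coeff, fourierCoeff, neg_neg] at this
      exact this
  have hz : ∀ φ : C(Torus, ℝ), ∫ x, φ x * d x = 0 := by
    intro φ
    have h1 : Λ ⟨fun x => (φ x : ℂ), by fun_prop⟩ = 0 := by rw [hΛ]; rfl
    have h2 : ∫ x, ((φ x * d x : ℝ) : ℂ) ∂haarAddCircle = 0 := by simpa [Λ] using h1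
    rw [integral_complex_ofReal] at h2
    rw [integral_torus, Complex.ofReal_eq_zero.1 h2, mul_zero]
  have hd0 : d =ᵐ[volume] 0 := by
    -- Indicators of closed sets are bounded pointwise limits of continuous functions, so vanishing
    -- against `C(𝕋)` passes to them by dominated convergence.
    refine ae_eq_zero_of_forall_setIntegral_isClosed_eq_zero hdi fun s hs => ?_
    have hlim : Tendsto (fun n : ℕ => ∫ x, (hs.apprSeq n x : ℝ) * d x) atTop
        (𝓝 (∫ x, s.indicator d x)) := by
      refine tendsto_integral_of_dominated_convergence (fun x => ‖d x‖) (fun n => ?_) hdi.norm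
        (fun n => .of_forall fun x => ?_) (.of_forall fun x => ?_)
      · exact (by fun_prop : Continuous fun x => (hs.apprSeq n x : ℝ)).aestronglyMeasurable.mul hdi.1
      · have : (hs.apprSeq n x : ℝ) ≤ 1 := by exact_mod_cast HasOuterApproxClosed.apprSeq_apply_le_one hs n x
        rw [norm_mul, Real.norm_of_nonneg (by positivity)]
        exact mul_le_of_le_one_left (norm_nonneg _) this
      · have h1 := tendsto_pi_nhds.1 (HasOuterApproxClosed.tendsto_apprSeq hs) x
        have h2 : Tendsto (fun n => (hs.apprSeq n x : ℝ)) atTop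
            (𝓝 ((s.indicator (fun _ => (1 : NNReal)) x : NNReal) : ℝ)) :=
          NNReal.tendsto_coe.2 h1
        convert h2.mul_const (d x) using 2
        by_cases hx : x ∈ s <;> simp [hx]
    rw [← integral_indicator hs.measurableSet]
    refine tendsto_nhds_unique hlim ?_
    have : ∀ n : ℕ, ∫ x, (hs.apprSeq n x : ℝ) * d x = 0 := fun n =>
      hz ⟨fun x => (hs.apprSeq n x : ℝ), by fun_prop⟩
    simp [this]
  filter_upwards [hd0] with x hx
  exact sub_eq_zero.1 hx

/-- Riesz–Fischer for real functions: a square summable sequence with the symmetry of a real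
function is the sequence of Fourier coefficients of a real square integrable function. -/
lemma exists_memLp_coeff_eq {a : ℤ → ℂ} (ha : Summable fun k => ‖a k‖ ^ 2)
    (hsymm : ∀ k, a (-k) = conj (a k)) :
    ∃ g : Torus → ℝ, MemLp g 2 volume ∧ ∀ k, coeff g k = a k := by
  let A : lp (fun _ : ℤ => ℂ) 2 := ⟨a, memℓp_gen (by simpa using ha)⟩
  let G := (fourierBasis (T := 2 * Real.pi)).repr.symm A
  have hG : ∀ k, fourierCoeff G k = a k := fun k => by
    rw [← fourierBasis_repr]; simp [G, A]
  have hGm : MemLp (G : Torus → ℂ) 2 (haarAddCircle : Measure Torus) := Lp.memLp G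
  have hGv : MemLp (G : Torus → ℂ) 2 (volume : Measure Torus) := memLp_haarAddCircle_iff.1 hGm
  refine ⟨fun x => (G x).re, hGv.re, fun k => ?_⟩
  have hGi : Integrable (G : Torus → ℂ) (haarAddCircle : Measure Torus) :=
    hGm.integrable (by norm_num)
  -- By the symmetry of `a`, `G` and its conjugate have the same coefficients, hence so does their
  -- half-sum, the real part of `G`.
  have hconj : fourierCoeff (fun x => conj (G x)) k = a k := by
    have h1 : fourierCoeff (fun x : Torus => conj (G x)) k = conj (fourierCoeff G (-k)) := by
      rw [fourierCoeff, fourierCoeff, ← integral_conj]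
      refine integral_congr_ae (.of_forall fun x => ?_)
      simp only [smul_eq_mul, map_mul, ← fourier_neg, neg_neg]
    rw [h1, hG, hsymm, Complex.conj_conj]
  have h2 : (fun x : Torus => (((G x).re : ℝ) : ℂ)) =
      fun x => (1 / 2 : ℂ) * (((G : Torus → ℂ) + fun x => conj (G x)) x) := by
    ext x
    rw [Complex.re_eq_add_conj]
    simp only [Pi.add_apply]; ring
  rw [coeff, h2, fourierCoeff.const_mul, fourierCoeff.add hGi]
  · rw [Pi.add_apply, hG, hconj]; ring
  · exact (Complex.conjLIE.toContinuousLinearEquiv : ℂ →L[ℝ] ℂ).integrable_comp hGi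

/-! ### Weak derivatives and continuous representatives. -/

lemma IsWeakDeriv.dx {f g : Torus → ℝ} (h : IsWeakDeriv f g) : IsWeakDeriv f (dx f) := by
  have hex : ∃ g, IsWeakDeriv f g := ⟨g, h⟩
  rw [ThinFilm.dx, dif_pos hex]
  exact hex.choose_spec

lemma IsWeakDeriv.dx_ae_eq {f g : Torus → ℝ} (h : IsWeakDeriv f g) :
    ThinFilm.dx f =ᵐ[volume] g :=
  ae_eq_of_coeff_eq h.dx.1 h.1 fun k => by rw [h.dx.2, h.2]

/-- The predicate from which `dx` chooses sees its argument only through the Fourier coefficients.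
The two choices therefore coincide exactly, not just almost everywhere, and `dx (dx ·)` can be
rewritten too. -/
lemma dx_congr_coeff {f f' : Torus → ℝ} (h : ∀ k, coeff f k = coeff f' k) : dx f = dx f' := by
  have : IsWeakDeriv f = IsWeakDeriv f' := by
    ext g; simp only [IsWeakDeriv, h]
  unfold dx
  rw [this]

/-- A square integrable function whose derivative is formally square integrable has a square
integrable weak derivative, which is its `dx`. -/
lemma memLp_dx {f : Torus → ℝ} (h : Summable fun k : ℤ => (k : ℝ) ^ 2 * ‖coeff f k‖ ^ 2) :
    IsWeakDeriv f (dx f) ∧ MemLp (dx f) 2 volume := by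
  obtain ⟨g, hg, hgc⟩ := exists_memLp_coeff_eq (a := fun k => Complex.I * k * coeff f k)
    (by simpa [mul_pow] using h) (fun k => by simp [coeff_neg_index])
  have hw : IsWeakDeriv f g := ⟨hg.integrable (by norm_num), hgc⟩
  exact ⟨hw.dx, hg.ae_eq hw.dx_ae_eq.symm⟩

lemma continuous_integral_continuousMap {E : Type*} [NormedAddCommGroup E] [NormedSpace ℝ E]
    [SecondCountableTopology E]
    (μ : Measure Torus) [IsFiniteMeasure μ] : Continuous fun φ : C(Torus, E) => ∫ x, φ x ∂μ := by
  have h : Continuous fun φ : C(Torus, E) => ∫ x, ContinuousMap.toLp 1 μ ℝ φ x ∂μ :=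
    continuous_integral.comp (ContinuousMap.toLp (E := E) 1 μ ℝ).continuous
  refine h.congr fun φ => integral_congr_ae (ContinuousMap.coeFn_toLp μ φ)

lemma integrable_continuous {f : Torus → ℝ} (hf : Continuous f) : Integrable f volume :=
  hf.integrable_of_hasCompactSupport (HasCompactSupport.of_compactSpace f)

/-- If the Fourier coefficients of a square integrable real function are summable, then it is a.e.
equal to the continuous sum of its Fourier series. -/
lemma exists_continuous_of_summable_coeff {f : Torus → ℝ} (hf : MemLp f 2 volume)
    (hs : Summable fun k => ‖coeff f k‖) :
    ∃ W : C(Torus, ℂ), HasSum (fun k => coeff f k • fourier k) W ∧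
      ∀ᵐ x, (f x : ℂ) = W x := by
  have hs' : Summable fun k => coeff f k • (fourier k : C(Torus, ℂ)) := by
    refine Summable.of_norm ?_
    simpa only [norm_smul, fourier_norm, mul_one] using hs
  refine ⟨_, hs'.hasSum, ?_⟩
  set W := ∑' k, coeff f k • (fourier k : C(Torus, ℂ))
  have h1 : HasSum (fun k => coeff f k • fourierLp 2 k)
      (ContinuousMap.toLp (E := ℂ) 2 haarAddCircle ℂ W) := by
    have := hs'.hasSum.mapL (ContinuousMap.toLp (E := ℂ) 2 haarAddCircle ℂ)
    simpa only [map_smul] using this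
  have h2 := hasSum_fourier_series_L2 ((memLp_ofReal_haar hf).toLp)
  simp only [fourierCoeff_toLp_ofReal hf] at h2
  have h3 := h1.unique h2
  have h4 : ∀ᵐ x ∂(haarAddCircle : Measure Torus), (f x : ℂ) = W x := by
    filter_upwards [ContinuousMap.coeFn_toLp (𝕜 := ℂ) (p := 2) haarAddCircle W,
      (memLp_ofReal_haar hf).coeFn_toLp] with x hx1 hx2
    rw [← hx1, h3, hx2]
  rw [volume_eq_smul_haarAddCircle]
  exact Measure.ae_smul_measure h4 _

/-! ### The space `H²` and the energy on it. -/

section Sobolev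

variable {f : Torus → ℝ}

lemma hsNormSq_lt_top_iff {s : ℝ} :
    hsNormSq s f < ∞ ↔ Summable fun k : ℤ => (1 + |(k : ℝ)| ^ (2 * s)) * ‖coeff f k‖ ^ 2 := by
  rw [hsNormSq, lt_top_iff_ne_top]
  constructor
  · intro h
    refine (ENNReal.summable_toReal h).congr fun k => ?_
    rw [ENNReal.toReal_ofReal (by positivity)]
  · intro h
    exact h.tsum_ofReal_ne_top

lemma abs_rpow_two_mul_two (k : ℤ) : |(k : ℝ)| ^ (2 * 2 : ℝ) = (k : ℝ) ^ 4 := by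
  rw [show (2 * 2 : ℝ) = ((4 : ℕ) : ℝ) by norm_num, Real.rpow_natCast, (by decide : Even 4).pow_abs]

lemma sq_le_pow_four (k : ℤ) : (k : ℝ) ^ 2 ≤ (k : ℝ) ^ 4 := by
  have : k ^ 2 ≤ k ^ 4 := by
    rcases eq_or_ne k 0 with rfl | h
    · simp
    · nlinarith [Int.one_le_abs h, sq_abs k, sq_nonneg (k ^ 2)]
  exact_mod_cast this

lemma MemHs.summable_pow_four (hf : MemHs 2 f) :
    Summable fun k : ℤ => (k : ℝ) ^ 4 * ‖coeff f k‖ ^ 2 := by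
  refine (hsNormSq_lt_top_iff.1 hf.2).of_nonneg_of_le (fun k => by positivity) fun k => ?_
  rw [abs_rpow_two_mul_two]
  gcongr
  simp

lemma memHs_two_of_summable (hf : MemLp f 2 volume)
    (h : Summable fun k : ℤ => (k : ℝ) ^ 4 * ‖coeff f k‖ ^ 2) : MemHs 2 f := by
  refine ⟨hf, hsNormSq_lt_top_iff.2 ?_⟩
  simp only [abs_rpow_two_mul_two, add_mul, one_mul]
  exact (hasSum_norm_sq_coeff hf).summable.add h

lemma MemHs.summable_sq (hf : MemHs 2 f) :
    Summable fun k : ℤ => (k : ℝ) ^ 2 * ‖coeff f k‖ ^ 2 :=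
  hf.summable_pow_four.of_nonneg_of_le (fun k => by positivity) fun k => by
    exact mul_le_mul_of_nonneg_right (sq_le_pow_four k) (sq_nonneg _)

lemma summable_inv_int_sq : Summable fun k : ℤ => 1 / (k : ℝ) ^ 2 :=
  Real.summable_one_div_int_pow.2 (by norm_num)

/-- Write the term as `(1/|k|) · (k² |f̂(k)|)` and bound the product by the sum of squares. This
gives the slope a uniformly convergent Fourier series. -/
lemma MemHs.summable_abs (hf : MemHs 2 f) :
    Summable fun k : ℤ => |(k : ℝ)| * ‖coeff f k‖ := by
  refine (summable_inv_int_sq.add hf.summable_pow_four).of_nonneg_of_le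
    (fun k => by positivity) fun k => ?_
  rcases eq_or_ne k 0 with rfl | hk
  · simp
  have hk' : 0 < |(k : ℝ)| := by positivity
  have h4 : (k : ℝ) ^ 4 = |(k : ℝ)| ^ 4 := ((by decide : Even 4).pow_abs _).symm
  rw [← sq_abs (k : ℝ), h4]
  set x := |(k : ℝ)|
  set y := ‖coeff f k‖
  have h : x * y = (1 / x) * (x ^ 2 * y) := by field_simp
  have h1 : 1 / x ^ 2 = (1 / x) ^ 2 := by rw [one_div_pow]
  have h2 : x ^ 4 * y ^ 2 = (x ^ 2 * y) ^ 2 := by ring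
  rw [h, h1, h2]
  nlinarith [sq_nonneg (1 / x - x ^ 2 * y), sq_nonneg (1 / x), sq_nonneg (x ^ 2 * y)]

lemma MemHs.isWeakDeriv_dx (hf : MemHs 2 f) : IsWeakDeriv f (dx f) := (memLp_dx hf.summable_sq).1

lemma MemHs.memLp_dx (hf : MemHs 2 f) : MemLp (dx f) 2 volume := (ThinFilm.memLp_dx hf.summable_sq).2

lemma MemHs.norm_coeff_dx (hf : MemHs 2 f) (k : ℤ) :
    ‖coeff (dx f) k‖ = |(k : ℝ)| * ‖coeff f k‖ := by
  rw [hf.isWeakDeriv_dx.2]; simp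

lemma MemHs.dx_dx (hf : MemHs 2 f) :
    IsWeakDeriv (dx f) (dx (dx f)) ∧ MemLp (dx (dx f)) 2 volume := by
  refine ThinFilm.memLp_dx (hf.summable_pow_four.congr fun k => ?_)
  rw [hf.norm_coeff_dx, mul_pow, sq_abs]; ring

lemma MemHs.norm_coeff_dx_dx (hf : MemHs 2 f) (k : ℤ) :
    ‖coeff (dx (dx f)) k‖ = (k : ℝ) ^ 2 * ‖coeff f k‖ := by
  rw [hf.dx_dx.1.2, norm_mul, hf.norm_coeff_dx, ← mul_assoc]
  congr 1
  simp [← sq]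

lemma MemHs.exists_continuous_dx (hf : MemHs 2 f) :
    ∃ W : C(Torus, ℂ), HasSum (fun k => coeff (dx f) k • fourier k) W ∧
      ∀ᵐ x, (dx f x : ℂ) = W x :=
  exists_continuous_of_summable_coeff hf.memLp_dx
    (by simpa only [hf.norm_coeff_dx] using hf.summable_abs)

lemma MemHs.exists_dx_ae_eq (hf : MemHs 2 f) : ∃ w : C(Torus, ℝ), dx f =ᵐ[volume] w := by
  obtain ⟨W, -, hW⟩ := hf.exists_continuous_dx
  refine ⟨⟨fun x => (W x).re, by fun_prop⟩, ?_⟩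
  filter_upwards [hW] with x hx
  simp [← hx]

/-- The double well potential. -/
def well (p : ℝ) : ℝ := 1 / 4 * (p ^ 2 - 1) ^ 2

lemma well_nonneg (p : ℝ) : 0 ≤ well p := by unfold well; positivity

@[fun_prop]
lemma continuous_well : Continuous well := by unfold well; fun_prop

lemma integrable_comp_of_ae_eq {u : Torus → ℝ} {w : C(Torus, ℝ)} (h : u =ᵐ[volume] w) {φ : ℝ → ℝ}
    (hφ : Continuous φ) : Integrable (fun x => φ (u x)) volume := by
  refine (integrable_continuous (hφ.comp w.continuous)).congr ?_
  filter_upwards [h] with x hx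
  simp [hx]

lemma MemHs.energy_eq (ν : ℝ) (hf : MemHs 2 f) :
    energy ν f = ν / 2 * (∫ x, dx (dx f) x ^ 2) + ∫ x, well (dx f x) := by
  obtain ⟨w, hw⟩ := hf.exists_dx_ae_eq
  have : energy ν f = ∫ x, (1 / 2 * ν * dx (dx f) x ^ 2 + well (dx f x)) := rfl
  rw [this, integral_add (hf.dx_dx.2.integrable_sq.const_mul _)
    (integrable_comp_of_ae_eq hw continuous_well), integral_const_mul]
  ring_nf

lemma MemHs.hasSum_dx_dx (hf : MemHs 2 f) :
    HasSum (fun k : ℤ => (k : ℝ) ^ 4 * ‖coeff f k‖ ^ 2)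
      ((2 * Real.pi)⁻¹ * ∫ x, dx (dx f) x ^ 2) := by
  convert hasSum_norm_sq_coeff hf.dx_dx.2 using 2 with k
  rw [hf.norm_coeff_dx_dx]; ring

lemma energy_nonneg {ν : ℝ} (hν : 0 ≤ ν) (f : Torus → ℝ) : 0 ≤ energy ν f :=
  integral_nonneg fun x => by positivity

end Sobolev

/-! ### The Modica–Mortola slope bound. -/

lemma exists_coe_mem_Icc (Y : ℝ) (x : Torus) :
    ∃ X : ℝ, (X : Torus) = x ∧ X ∈ Set.Icc Y (Y + 2 * Real.pi) := by
  obtain ⟨X, hX⟩ := (AddCircle.equivIco (2 * Real.pi) Y).symm.surjective x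
  exact ⟨X, hX, Set.Ico_subset_Icc_self X.2⟩

/-- If the lift of `P` to the line has derivative the lift of `D`, then the variation of
`P³/3 - P` is controlled by the energy. -/
lemma abs_cubic_sub_le {ν : ℝ} (hν : 0 < ν) {P D : Torus → ℝ} (hP : Continuous P)
    (hD : Continuous D) (hPD : ∀ X : ℝ, HasDerivAt (fun z : ℝ => P z) (D X) X) (x y : Torus) :
    √(ν / 2) * |(P x ^ 3 / 3 - P x) - (P y ^ 3 / 3 - P y)| ≤
      ν / 2 * (∫ z, D z ^ 2) + ∫ z, well (P z) := by
  obtain ⟨Y, rfl⟩ := QuotientAddGroup.mk_surjective y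
  -- With `X` at most one period to the right of `Y`, the integral from `Y` to `X` is bounded by the
  -- energy over a single period.
  obtain ⟨X, rfl, hX⟩ := exists_coe_mem_Icc Y x
  have hmk : Continuous fun z : ℝ => (z : Torus) := AddCircle.continuous_mk' _
  have hder : ∀ z : ℝ, HasDerivAt (fun z : ℝ => P z ^ 3 / 3 - P z) ((P z ^ 2 - 1) * D z) z := by
    intro z
    refine ((((hPD z).pow 3).div_const 3).sub (hPD z)).congr_deriv ?_
    norm_num; ring
  have hc : Continuous fun z : ℝ => (P z ^ 2 - 1) * D z := by fun_prop
  have hftc := intervalIntegral.integral_eq_sub_of_hasDerivAt (a := Y) (b := X)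
    (fun z _ => hder z) (hc.intervalIntegrable _ _)
  change √(ν / 2) * |(P X ^ 3 / 3 - P X) - (P Y ^ 3 / 3 - P Y)| ≤ _
  rw [← hftc]
  have hE : Continuous fun z : Torus => ν / 2 * D z ^ 2 + well (P z) := by fun_prop
  have hE' : Continuous fun z : ℝ => ν / 2 * D z ^ 2 + well (P z) := hE.comp hmk
  calc √(ν / 2) * |∫ z in Y..X, (P z ^ 2 - 1) * D z|
      ≤ √(ν / 2) * ∫ z in Y..X, |(P z ^ 2 - 1) * D z| := by
        gcongr
        exact intervalIntegral.abs_integral_le_integral_abs hX.1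
    _ = ∫ z in Y..X, √(ν / 2) * |(P z ^ 2 - 1) * D z| := by
        rw [intervalIntegral.integral_const_mul]
    _ ≤ ∫ z in Y..X, (ν / 2 * D z ^ 2 + well (P z)) := by
        refine intervalIntegral.integral_mono_on hX.1
          ((continuous_const.mul hc.abs).intervalIntegrable _ _) (hE'.intervalIntegrable _ _)
          fun z _ => ?_
        have h1 : √(ν / 2) ^ 2 = ν / 2 := Real.sq_sqrt (by positivity)
        -- The Modica–Mortola inequality: expanding this square gives exactly the energy density
        -- minus the integrand.
        have h2 := sq_nonneg (√(ν / 2) * |D z| - 1 / 2 * |P z ^ 2 - 1|)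
        rw [abs_mul, well]
        nlinarith [sq_abs (D z), sq_abs (P z ^ 2 - 1)]
    _ ≤ ∫ z in Y..Y + 2 * Real.pi, (ν / 2 * D z ^ 2 + well (P z)) := by
        refine intervalIntegral.integral_mono_interval le_rfl hX.1 hX.2 ?_
          (hE'.intervalIntegrable _ _)
        exact .of_forall fun z => add_nonneg (by positivity) (well_nonneg _)
    _ = ∫ z : Torus, (ν / 2 * D z ^ 2 + well (P z)) :=
        AddCircle.intervalIntegral_preimage (2 * Real.pi) Y
          (fun z : Torus => ν / 2 * D z ^ 2 + well (P z))
    _ = ν / 2 * (∫ z, D z ^ 2) + ∫ z, well (P z) := by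
        rw [integral_add, integral_const_mul]
        · exact integrable_continuous (by fun_prop)
        · exact integrable_continuous (by fun_prop)

lemma hasDerivAt_trigPoly (a : ℤ → ℂ) (s : Finset ℤ) (X : ℝ) :
    HasDerivAt (fun z : ℝ => ((∑ k ∈ s, a k • fourier k : C(Torus, ℂ)) (z : Torus)).re)
      ((∑ k ∈ s, (Complex.I * k * a k) • fourier k : C(Torus, ℂ)) (X : Torus)).re X := by
  have h : HasDerivAt (fun z : ℝ => (∑ k ∈ s, a k • fourier k : C(Torus, ℂ)) (z : Torus))
      ((∑ k ∈ s, (Complex.I * k * a k) • fourier k : C(Torus, ℂ)) (X : Torus)) X := by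
    simp only [ContinuousMap.sum_apply, ContinuousMap.smul_apply]
    refine HasDerivAt.fun_sum fun k _ => ?_
    refine ((hasDerivAt_fourier (2 * Real.pi) k X).const_smul (a k)).congr_deriv ?_
    have : (2 * Real.pi : ℂ) ≠ 0 := by exact_mod_cast Real.two_pi_pos.ne'
    simp only [smul_eq_mul]
    push_cast
    field_simp
  exact (Complex.reCLM.hasFDerivAt.comp_hasDerivAt X h)

lemma norm_sq_Lp_haar (F : Lp ℂ 2 (haarAddCircle : Measure Torus)) :
    ‖F‖ ^ 2 = ∫ x, ‖F x‖ ^ 2 ∂haarAddCircle := by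
  have h := congr_arg RCLike.re (L2.inner_def (𝕜 := ℂ) F F)
  rw [← integral_re (L2.integrable_inner F F)] at h
  simpa only [← norm_sq_eq_re_inner] using h

/-- The `L²` norms of the partial sums of the Fourier series converge. -/
lemma tendsto_integral_norm_sq_trigPoly {f : Torus → ℝ} (hf : MemLp f 2 volume) :
    Tendsto (fun s : Finset ℤ => ∫ x : Torus, ‖(∑ k ∈ s, coeff f k • fourier k : C(Torus, ℂ)) x‖ ^ 2)
      atTop (𝓝 (∫ x, f x ^ 2)) := by
  have h := hasSum_fourier_series_L2 ((memLp_ofReal_haar hf).toLp)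
  simp only [fourierCoeff_toLp_ofReal hf] at h
  have h2 : Tendsto (fun s : Finset ℤ => 2 * Real.pi * ‖∑ k ∈ s, coeff f k • fourierLp 2 k‖ ^ 2)
      atTop (𝓝 (2 * Real.pi * ‖(memLp_ofReal_haar hf).toLp‖ ^ 2)) :=
    (h.norm.pow 2).const_mul (2 * Real.pi)
  convert h2 using 2 with s
  · rw [integral_torus]
    congr 1
    have : ∑ k ∈ s, coeff f k • fourierLp 2 k = ContinuousMap.toLp (E := ℂ) 2 haarAddCircle ℂ
        (∑ k ∈ s, coeff f k • fourier k : C(Torus, ℂ)) := by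
      simp only [map_sum, map_smul]
    rw [this, norm_sq_Lp_haar]
    refine integral_congr_ae ?_
    filter_upwards [ContinuousMap.coeFn_toLp (𝕜 := ℂ) (p := 2) haarAddCircle
      (∑ k ∈ s, coeff f k • fourier k : C(Torus, ℂ))] with x hx
    rw [hx]
  · rw [integral_torus, norm_sq_Lp_haar]
    congr 1
    refine integral_congr_ae ?_
    filter_upwards [(memLp_ofReal_haar hf).coeFn_toLp] with x hx
    rw [hx]
    simp

lemma exists_eq_zero_of_integral_eq_zero {w : Torus → ℝ} (hw : Continuous w)
    (h : ∫ x, w x = 0) : ∃ y, w y = 0 := by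
  have hi : Integrable w (haarAddCircle : Measure Torus) :=
    hw.integrable_of_hasCompactSupport (HasCompactSupport.of_compactSpace w)
  have h0 : ∫ x, w x ∂haarAddCircle = 0 := by
    rw [integral_torus] at h
    exact (mul_eq_zero.1 h).resolve_left Real.two_pi_pos.ne'
  obtain ⟨a, ha⟩ := exists_le_integral hi
  obtain ⟨b, hb⟩ := exists_integral_le hi
  rw [h0] at ha hb
  exact mem_range_of_exists_le_of_exists_ge hw ⟨a, ha⟩ ⟨b, hb⟩

lemma coeff_zero_eq_zero_iff {f : Torus → ℝ} : coeff f 0 = 0 ↔ ∫ x, f x = 0 := by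
  rw [coeff, fourierCoeff]
  simp only [neg_zero, fourier_zero, one_smul]
  rw [integral_complex_ofReal, integral_torus]
  simp [Real.pi_ne_zero]

lemma continuous_integral_well : Continuous fun φ : C(Torus, ℝ) => ∫ z, well (φ z) := by
  have hpow : Continuous fun φ : C(Torus, ℝ) => (1 / 4 : ℝ) • (φ ^ 2 - 1) ^ 2 := by fun_prop
  exact (continuous_integral_continuousMap volume).comp hpow

/-- The slope of a function in `H²` is controlled by its energy. -/
lemma MemHs.exists_dx_ae_eq_cubic_le {ν : ℝ} (hν : 0 < ν) {f : Torus → ℝ} (hf : MemHs 2 f) :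
    ∃ w : C(Torus, ℝ), dx f =ᵐ[volume] w ∧
      ∀ x, √(ν / 2) * |w x ^ 3 / 3 - w x| ≤ energy ν f := by
  obtain ⟨W, hW, hWae⟩ := hf.exists_continuous_dx
  let Re : C(Torus, ℂ) →L[ℝ] C(Torus, ℝ) := Complex.reCLM.compLeftContinuous ℝ Torus
  have hw : dx f =ᵐ[volume] Re W := by
    filter_upwards [hWae] with x hx
    change dx f x = (W x).re
    simp [← hx]
  refine ⟨Re W, hw, fun x => ?_⟩
  obtain ⟨y, hy⟩ : ∃ y, Re W y = 0 := by
    refine exists_eq_zero_of_integral_eq_zero (Re W).continuous ?_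
    rw [← integral_congr_ae hw, ← coeff_zero_eq_zero_iff, hf.isWeakDeriv_dx.2]
    simp
  -- The fundamental theorem of calculus is applied to trigonometric partial sums. The slopes
  -- converge uniformly and the curvatures in `L²`, which suffices to pass to the limit in the
  -- energy. A partial sum need not vanish at `y`, so both endpoint terms are kept until the limit.
  set P : Finset ℤ → C(Torus, ℂ) := fun s => ∑ k ∈ s, coeff (dx f) k • fourier k with hPdef
  set D : Finset ℤ → C(Torus, ℂ) := fun s => ∑ k ∈ s, coeff (dx (dx f)) k • fourier k with hDdef
  have hP : Tendsto (fun s => Re (P s)) atTop (𝓝 (Re W)) := (Re.continuous.tendsto W).comp hW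
  have hPx : ∀ z, Tendsto (fun s => Re (P s) z) atTop (𝓝 (Re W z)) := fun z =>
    ((ContinuousEvalConst.continuous_eval_const z).tendsto _).comp hP
  have hbound : ∀ s, √(ν / 2) * |(Re (P s) x ^ 3 / 3 - Re (P s) x)
      - (Re (P s) y ^ 3 / 3 - Re (P s) y)| ≤
      ν / 2 * (∫ z : Torus, ‖D s z‖ ^ 2) + ∫ z, well (Re (P s) z) := by
    intro s
    refine (abs_cubic_sub_le hν (P := Re (P s)) (D := fun z => (D s z).re) (by fun_prop)
      (by fun_prop) (fun X => ?_) x y).trans ?_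
    · have := hasDerivAt_trigPoly (coeff (dx f)) s X
      simp only [← hf.dx_dx.1.2] at this
      exact this
    · gcongr
      · exact integrable_continuous (by fun_prop)
      · exact integrable_continuous (by fun_prop)
      · intro z
        change (D s z).re ^ 2 ≤ ‖D s z‖ ^ 2
        rw [← sq_abs]
        gcongr
        exact Complex.abs_re_le_norm _
  have hlim1 : Tendsto (fun s => √(ν / 2) * |(Re (P s) x ^ 3 / 3 - Re (P s) x)
      - (Re (P s) y ^ 3 / 3 - Re (P s) y)|) atTop (𝓝 (√(ν / 2) * |Re W x ^ 3 / 3 - Re W x|)) := by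
    have := (((((hPx x).pow 3).div_const 3).sub (hPx x)).sub
      ((((hPx y).pow 3).div_const 3).sub (hPx y))).abs.const_mul (√(ν / 2))
    simpa [hy] using this
  have hlim2 := ((tendsto_integral_norm_sq_trigPoly hf.dx_dx.2).const_mul (ν / 2)).add
    ((continuous_integral_well.tendsto (Re W)).comp hP)
  refine (le_of_tendsto_of_tendsto' hlim1 hlim2 hbound).trans_eq ?_
  rw [hf.energy_eq]
  congr 1
  refine integral_congr_ae ?_
  filter_upwards [hw] with z hz
  rw [hz]

/-- The slope bound in terms of the energy. -/
lemma MemHs.gradSup_le {ν E : ℝ} (hν : 0 < ν) {f : Torus → ℝ} (hf : MemHs 2 f)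
    (hE : energy ν f ≤ E) :
    gradSup f ≤ ENNReal.ofReal (3 * max 1 (ν ^ (-(1 / 6) : ℝ) * E ^ (1 / 3 : ℝ))) := by
  obtain ⟨w, hw, hb⟩ := hf.exists_dx_ae_eq_cubic_le hν
  have hE0 : 0 ≤ E := (energy_nonneg hν.le f).trans hE
  rw [gradSup, eLpNorm_exponent_top]
  refine eLpNormEssSup_le_of_ae_bound ?_
  filter_upwards [hw] with x hx
  rw [hx, Real.norm_eq_abs]
  -- If `a = |u|` exceeds both `3` and `3m`, then `a < a³/9`, so `a³/3 - a > 2a³/9 ≥ 6m³`. The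
  -- energy bound allows only `√2 m³`.
  by_contra! hlt
  set m := ν ^ (-(1 / 6) : ℝ) * E ^ (1 / 3 : ℝ) with hm
  have hm0 : 0 ≤ m := by positivity
  have hm3 : m ^ 3 = ν ^ (-(1 / 2) : ℝ) * E := by
    rw [hm, mul_pow, ← Real.rpow_natCast, ← Real.rpow_natCast, ← Real.rpow_mul hν.le,
      ← Real.rpow_mul hE0]
    norm_num
  have hsq : √ν * m ^ 3 = E := by
    rw [hm3, Real.sqrt_eq_rpow, ← mul_assoc, ← Real.rpow_add hν]
    norm_num
  set a := |w x| with ha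
  have h1 : 3 < a := by
    have := le_max_left 1 m; linarith
  have h2 : 3 * m < a := by
    have := le_max_right 1 m; linarith
  have h3 : a ^ 3 / 3 - a ≤ |w x ^ 3 / 3 - w x| := by
    refine le_trans (le_of_eq ?_) (abs_sub_abs_le_abs_sub _ _)
    rw [abs_div, abs_pow, ← ha]; norm_num
  have h4 : √ν = √2 * √(ν / 2) := by
    rw [← Real.sqrt_mul (by norm_num)]; congr 1; ring
  have h5 : 0 < √(ν / 2) := Real.sqrt_pos.2 (by positivity)
  have h6 : √2 ≤ 2 := by rw [Real.sqrt_le_left] <;> norm_num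
  have h7 : √(ν / 2) * |w x ^ 3 / 3 - w x| ≤ √(ν / 2) * (√2 * m ^ 3) := by
    refine ((hb x).trans hE).trans_eq ?_
    rw [← hsq, h4]; ring
  have h8 := le_of_mul_le_mul_left h7 h5
  have h9 : (3 * m) ^ 3 < a ^ 3 := by gcongr
  have h10 : 0 ≤ m ^ 3 := by positivity
  have h11 : 9 * a < a ^ 3 := by nlinarith [mul_pos (sub_pos.2 h1) (by linarith : 0 < a + 3)]
  nlinarith [mul_le_mul_of_nonneg_right h6 h10]

/-! ### Regularity of solutions at positive times. -/

section Solution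

variable {ν : ℝ} {h₀ : Torus → ℝ} {h : ℝ → Torus → ℝ}

/-- For positive times the slope of a solution is continuous in time with values in `C(𝕋)`, and it
is `O(t^{-1/4})` at the initial time. -/
lemma IsGlobalSolution.exists_slope (hs : IsGlobalSolution ν h₀ h) :
    ∃ U : ℝ → C(Torus, ℝ), ContinuousOn U (Set.Ioi 0) ∧
      (∀ t, 0 < t → dx (h t) =ᵐ[volume] U t) ∧
      ∀ T, ∃ M, 0 ≤ M ∧ ∀ t ∈ Set.Ioc 0 T, ‖U t‖ ≤ M * t ^ (-(1 / 4) : ℝ) := by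
  obtain ⟨w, hw, hwae⟩ := hs.continuous_grad
  -- Undoing the weight `t^{1/4}` is possible only for `t > 0`; at `t = 0` the weight vanishes and
  -- carries no information on the slope.
  refine ⟨fun t => t ^ (-(1 / 4) : ℝ) • w t, ?_, fun t ht => ?_, fun T => ?_⟩
  · have : ContinuousOn (fun t : ℝ => t ^ (-(1 / 4) : ℝ)) (Set.Ioi 0) := fun t ht =>
      (Real.continuousAt_rpow_const t _ (Or.inl (ne_of_gt ht))).continuousWithinAt
    exact this.smul (hw.mono Set.Ioi_subset_Ici_self)
  · filter_upwards [hwae t ht.le] with x hx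
    rw [ContinuousMap.smul_apply, ← hx, smul_eq_mul, ← mul_assoc, ← Real.rpow_add ht]
    norm_num
  · obtain ⟨M, hM⟩ := (isCompact_Icc (a := (0 : ℝ)) (b := T)).exists_bound_of_continuousOn
      (hw.mono Set.Icc_subset_Ici_self)
    refine ⟨max M 0, le_max_right _ _, fun t ht => ?_⟩
    rw [norm_smul, Real.norm_of_nonneg (Real.rpow_nonneg ht.1.le _), mul_comm]
    have := Real.rpow_nonneg ht.1.le (-(1 / 4) : ℝ)
    gcongr
    exact (hM t ⟨ht.1.le, ht.2⟩).trans (le_max_left _ _)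

lemma integral_haar_abs_le {f : Torus → ℝ} {M : ℝ} (h : ∀ᵐ x, |f x| ≤ M) :
    ∫ x, |f x| ∂(haarAddCircle : Measure Torus) ≤ M := by
  have := norm_integral_le_of_norm_le_const (μ := (haarAddCircle : Measure Torus))
    (f := fun x => |f x|) (C := M) (by simpa using ae_haar h)
  simpa using (le_abs_self _).trans this

lemma coeff_flux_eq {f : Torus → ℝ} {w : C(Torus, ℝ)} (hw : dx f =ᵐ[volume] w) (k : ℤ) :
    coeff (flux f) k = coeff ((w ^ 2 - 1) * w : C(Torus, ℝ)) k := by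
  refine coeff_congr_ae ?_ k
  filter_upwards [hw] with x hx
  simp [flux, hx]

lemma continuous_coeff (k : ℤ) : Continuous fun w : C(Torus, ℝ) => coeff w k := by
  let O : C(Torus, ℝ) →L[ℝ] C(Torus, ℂ) := Complex.ofRealCLM.compLeftContinuous ℝ Torus
  have : Continuous fun w : C(Torus, ℝ) => fourier (-k) * O w := by fun_prop
  exact (continuous_integral_continuousMap haarAddCircle).comp this

lemma norm_coeff_continuousMap_le (w : C(Torus, ℝ)) (k : ℤ) : ‖coeff w k‖ ≤ ‖w‖ :=
  (norm_coeff_le _ _).trans (integral_haar_abs_le (.of_forall fun x => w.norm_coe_le_norm x))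

lemma IsGlobalSolution.continuousOn_coeff_flux (hs : IsGlobalSolution ν h₀ h) (k : ℤ) :
    ContinuousOn (fun s => coeff (flux (h s)) k) (Set.Ioi 0) := by
  obtain ⟨U, hU, hUae, -⟩ := hs.exists_slope
  have : ContinuousOn (fun s => coeff ((U s ^ 2 - 1) * U s : C(Torus, ℝ)) k) (Set.Ioi 0) :=
    (continuous_coeff k).comp_continuousOn (((hU.pow 2).sub continuousOn_const).mul hU)
  exact this.congr fun s hs' => coeff_flux_eq (hUae s hs') k

/-- The flux is cubic in a slope of size `t^{-1/4}`. The resulting `t^{-3/4}` is integrable at `0`,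
so Duhamel's integral converges absolutely. -/
lemma IsGlobalSolution.norm_coeff_flux_le (hs : IsGlobalSolution ν h₀ h) (T : ℝ) :
    ∃ M, 0 ≤ M ∧ ∀ s ∈ Set.Ioc 0 T, ∀ k, ‖coeff (flux (h s)) k‖ ≤
      M * (s ^ (-(3 / 4) : ℝ) + s ^ (-(1 / 4) : ℝ)) := by
  obtain ⟨U, -, hUae, hM⟩ := hs.exists_slope
  obtain ⟨M, hM0, hM⟩ := hM T
  refine ⟨M ^ 3 + M, by positivity, fun s hs' k => ?_⟩
  rw [coeff_flux_eq (hUae s hs'.1) k]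
  have h1 := hM s hs'
  set r := s ^ (-(1 / 4) : ℝ) with hr
  have hr0 : 0 ≤ r := Real.rpow_nonneg hs'.1.le _
  have hr3 : s ^ (-(3 / 4) : ℝ) = r ^ 3 := by
    rw [hr, ← Real.rpow_natCast, ← Real.rpow_mul hs'.1.le]; norm_num
  have h2 : ‖(U s ^ 2 - 1) * U s‖ ≤ (‖U s‖ ^ 2 + 1) * ‖U s‖ := by
    refine (norm_mul_le _ _).trans ?_
    gcongr
    refine (norm_sub_le _ _).trans ?_
    gcongr
    · exact norm_pow_le _ _
    · simp
  calc _ ≤ _ := norm_coeff_continuousMap_le _ k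
    _ ≤ _ := h2
    _ ≤ ((M * r) ^ 2 + 1) * (M * r) := by gcongr
    _ ≤ (M ^ 3 + M) * (r ^ 3 + r) := by
      have h3 : 0 ≤ M ^ 3 * r + M * r ^ 3 := by positivity
      nlinarith
    _ = _ := by rw [hr3]

lemma IsGlobalSolution.norm_coeff_flux_le_of_pos (hs : IsGlobalSolution ν h₀ h) {a : ℝ}
    (ha : 0 < a) (T : ℝ) :
    ∃ B, 0 ≤ B ∧ ∀ s ∈ Set.Icc a T, ∀ k, ‖coeff (flux (h s)) k‖ ≤ B := by
  obtain ⟨M, hM0, hM⟩ := hs.norm_coeff_flux_le T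
  refine ⟨M * (a ^ (-(3 / 4) : ℝ) + a ^ (-(1 / 4) : ℝ)), by positivity, fun s hs' k => ?_⟩
  refine (hM s ⟨ha.trans_le hs'.1, hs'.2⟩ k).trans ?_
  gcongr M * (?_ + ?_)
  · exact Real.rpow_le_rpow_of_nonpos ha hs'.1 (by norm_num)
  · exact Real.rpow_le_rpow_of_nonpos ha hs'.1 (by norm_num)

lemma IsGlobalSolution.intervalIntegrable (hs : IsGlobalSolution ν h₀ h) (c : ℝ) (k : ℤ) {t : ℝ}
    (ht : 0 ≤ t) :
    IntervalIntegrable (fun s => (Real.exp (c * s) : ℂ) * coeff (flux (h s)) k) volume 0 t := by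
  obtain ⟨M, hM0, hM⟩ := hs.norm_coeff_flux_le t
  have h1 : IntervalIntegrable (fun s : ℝ => M * (s ^ (-(3 / 4) : ℝ) + s ^ (-(1 / 4) : ℝ)))
      volume 0 t :=
    ((intervalIntegral.intervalIntegrable_rpow' (by norm_num)).add
      (intervalIntegral.intervalIntegrable_rpow' (by norm_num))).const_mul M
  have h2 : IntervalIntegrable (fun s => coeff (flux (h s)) k) volume 0 t := by
    refine h1.mono_fun ?_ ?_
    · rw [Set.uIoc_of_le ht]
      exact ((hs.continuousOn_coeff_flux k).mono Set.Ioc_subset_Ioi_self).aestronglyMeasurable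
        measurableSet_Ioc
    · rw [Set.uIoc_of_le ht]
      filter_upwards [ae_restrict_mem measurableSet_Ioc] with s hs'
      exact (hM s hs' k).trans (le_abs_self _)
  exact h2.continuousOn_mul (by fun_prop)

/-- Duhamel's formula with the exponential factored out. -/
lemma IsGlobalSolution.coeff_eq (hs : IsGlobalSolution ν h₀ h) (k : ℤ) {t : ℝ} (ht : 0 ≤ t) :
    coeff (h t) k = (Real.exp (-(ν * k ^ 4) * t) : ℂ) * (coeff h₀ k + Complex.I * k *
      ∫ s in (0 : ℝ)..t, (Real.exp (ν * k ^ 4 * s) : ℂ) * coeff (flux (h s)) k) := by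
  rw [hs.duhamel t ht k, mul_add, ← intervalIntegral.integral_const_mul,
    ← intervalIntegral.integral_const_mul]
  congr 1
  · congr 3; ring
  · refine intervalIntegral.integral_congr fun s _ => ?_
    have : Real.exp (-(ν * (t - s) * k ^ 4)) =
        Real.exp (-(ν * k ^ 4) * t) * Real.exp (ν * k ^ 4 * s) := by
      rw [← Real.exp_add]; congr 1; ring
    simp only [this]
    push_cast; ring

lemma hasDerivAt_ofReal_exp_mul (c t : ℝ) :
    HasDerivAt (fun s : ℝ => (Real.exp (c * s) : ℂ)) (c * (Real.exp (c * t) : ℂ)) t := by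
  have h1 : HasDerivAt (fun s : ℝ => Real.exp (c * s)) (c * Real.exp (c * t)) t := by
    refine ((hasDerivAt_id t).const_mul c).exp.congr_deriv ?_
    simp only [id, mul_one]; ring
  convert h1.ofReal_comp using 1
  push_cast; ring

/-- The equation, coefficient by coefficient. -/
lemma IsGlobalSolution.hasDerivAt_coeff (hs : IsGlobalSolution ν h₀ h) (k : ℤ) {t : ℝ}
    (ht : 0 < t) :
    HasDerivAt (fun s => coeff (h s) k)
      (-(ν * k ^ 4) * coeff (h t) k + Complex.I * k * coeff (flux (h t)) k) t := by
  have hcont : ContinuousOn (fun s : ℝ => (Real.exp (ν * k ^ 4 * s) : ℂ) * coeff (flux (h s)) k)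
      (Set.Ioi 0) := by
    refine ContinuousOn.mul (by fun_prop) (hs.continuousOn_coeff_flux k)
  have hG := intervalIntegral.integral_hasDerivAt_right (hs.intervalIntegrable (ν * k ^ 4) k ht.le)
    (hcont.stronglyMeasurableAtFilter isOpen_Ioi t ht) (hcont.continuousAt (Ioi_mem_nhds ht))
  have hE := hasDerivAt_ofReal_exp_mul (-(ν * k ^ 4)) t
  have hprod := hE.mul ((hG.const_mul (Complex.I * k)).const_add (coeff h₀ k))
  refine HasDerivAt.congr_of_eventuallyEq (hprod.congr_deriv ?_) ?_
  · have : (Real.exp (-(ν * k ^ 4) * t) : ℂ) * (Real.exp (ν * k ^ 4 * t) : ℂ) = 1 := by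
      rw [← Complex.ofReal_mul, ← Real.exp_add]; simp
    rw [hs.coeff_eq k ht.le]
    push_cast at this ⊢
    linear_combination (Complex.I * k * coeff (flux (h t)) k) * this
  · filter_upwards [Ioi_mem_nhds ht] with s hs'
    exact hs.coeff_eq k (le_of_lt hs')

/-- Smoothing: for positive times the coefficients decay like `|k|^{-3}`. -/
lemma IsGlobalSolution.norm_coeff_le (hs : IsGlobalSolution ν h₀ h) (hν : 0 < ν) {a : ℝ}
    (ha : 0 < a) (T : ℝ) :
    ∃ C, 0 ≤ C ∧ ∀ t ∈ Set.Icc a T, ∀ k : ℤ, |(k : ℝ)| ^ 3 * ‖coeff (h t) k‖ ≤ C := by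
  set b := a / 2 with hb
  have hb0 : 0 < b := by positivity
  obtain ⟨B, hB0, hB⟩ := hs.norm_coeff_flux_le_of_pos hb0 T
  set N := ∫ x, |h b x| ∂(haarAddCircle : Measure Torus) with hN
  have hN0 : 0 ≤ N := integral_nonneg fun x => abs_nonneg _
  refine ⟨N / (ν * b) + B / ν, by positivity, fun t ht k => ?_⟩
  rcases eq_or_ne k 0 with rfl | hk
  · simp; positivity
  have hk1 : 1 ≤ |(k : ℝ)| := by exact_mod_cast Int.one_le_abs hk
  have hk4 : (k : ℝ) ^ 4 = |(k : ℝ)| ^ 4 := ((by decide : Even 4).pow_abs _).symm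
  have hbt : b ≤ t - b := by rw [hb]; linarith [ht.1]
  set q := |(k : ℝ)| with hq
  set lam := ν * (k : ℝ) ^ 4 with hlam
  have hlam0 : 0 < lam := by rw [hlam, hk4]; positivity
  -- restart Duhamel's formula at time `b`
  have heq : coeff (h t) k = (Real.exp (-lam * (t - b)) : ℂ) * coeff (h b) k +
      (Real.exp (-lam * t) : ℂ) * (Complex.I * k *
        ∫ s in b..t, (Real.exp (lam * s) : ℂ) * coeff (flux (h s)) k) := by
    have hI0 := hs.intervalIntegrable lam k hb0.le
    have hI1 := hs.intervalIntegrable lam k (by linarith : 0 ≤ t)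
    rw [hs.coeff_eq k (by linarith : 0 ≤ t), hs.coeff_eq k hb0.le,
      ← intervalIntegral.integral_interval_sub_left hI1 hI0, ← hlam]
    have : (Real.exp (-lam * (t - b)) : ℂ) * (Real.exp (-lam * b) : ℂ) = Real.exp (-lam * t) := by
      rw [← Complex.ofReal_mul, ← Real.exp_add]; congr 2; ring
    rw [← mul_assoc, this]
    ring
  have hint : ‖∫ s in b..t, (Real.exp (lam * s) : ℂ) * coeff (flux (h s)) k‖ ≤
      B * (Real.exp (lam * t) / lam) := by
    have h1 : ‖∫ s in b..t, (Real.exp (lam * s) : ℂ) * coeff (flux (h s)) k‖ ≤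
        ∫ s in b..t, Real.exp (lam * s) * B := by
      refine intervalIntegral.norm_integral_le_of_norm_le (by linarith) (.of_forall fun s hs' => ?_)
        (Continuous.intervalIntegrable (by fun_prop) _ _)
      rw [norm_mul, Complex.norm_real, Real.norm_of_nonneg (Real.exp_pos _).le]
      gcongr
      exact hB s ⟨hs'.1.le, hs'.2.trans ht.2⟩ k
    refine h1.trans ?_
    rw [intervalIntegral.integral_mul_const, mul_comm]
    gcongr
    rw [intervalIntegral.integral_comp_mul_left _ hlam0.ne', integral_exp, smul_eq_mul,
      inv_mul_eq_div]
    gcongr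
    linarith [Real.exp_pos (lam * b)]
  -- Polynomial decay of the semigroup is enough: `1/λ` gains four powers of `k`. The Duhamel term
  -- also gains `1/λ`, but loses one power to the derivative, which leaves three.
  have hexp : Real.exp (-lam * (t - b)) ≤ 1 / (lam * b) := by
    have h2 : lam * b ≤ Real.exp (lam * (t - b)) := by
      have := Real.add_one_le_exp (lam * (t - b))
      have : lam * b ≤ lam * (t - b) := by gcongr
      linarith
    rw [neg_mul, Real.exp_neg, ← one_div]
    exact one_div_le_one_div_of_le (by positivity) h2
  have hcb : ‖coeff (h b) k‖ ≤ N := ThinFilm.norm_coeff_le _ _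
  have hmain : ‖coeff (h t) k‖ ≤ 1 / (lam * b) * N +
      Real.exp (-lam * t) * (q * (B * (Real.exp (lam * t) / lam))) := by
    rw [heq]
    refine (norm_add_le _ _).trans ?_
    simp only [norm_mul, Complex.norm_real, Complex.norm_I, one_mul, Complex.norm_intCast,
      Real.norm_of_nonneg (Real.exp_pos _).le]
    gcongr
  have hee : Real.exp (-lam * t) * Real.exp (lam * t) = 1 := by
    rw [← Real.exp_add]; simp
  calc q ^ 3 * ‖coeff (h t) k‖ ≤ q ^ 3 * (1 / (lam * b) * N +
      Real.exp (-lam * t) * (q * (B * (Real.exp (lam * t) / lam)))) := by gcongr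
    _ = q ^ 3 * (1 / (lam * b) * N + (Real.exp (-lam * t) * Real.exp (lam * t)) * q * B / lam) := by
      ring
    _ = N / (ν * b) / q + B / ν := by
      rw [hee, hlam, hk4]
      have : 0 < q := by linarith
      field_simp
    _ ≤ N / (ν * b) + B / ν := by
      exact add_le_add_left (div_le_self (by positivity) hk1) _

lemma IsGlobalSolution.coeff_zero (hs : IsGlobalSolution ν h₀ h) (k : ℤ) :
    coeff (h 0) k = coeff h₀ k := coeff_congr_ae hs.initial k

lemma pow_four_mul_sq_le_of_cubic_decay {c : ℤ → ℂ} {C : ℝ} (hC : ∀ k : ℤ, |(k : ℝ)| ^ 3 * ‖c k‖ ≤ C)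
    (k : ℤ) : (k : ℝ) ^ 4 * ‖c k‖ ^ 2 ≤ C ^ 2 * (1 / (k : ℝ) ^ 2) := by
  rcases eq_or_ne k 0 with rfl | hk
  · simp
  have hk0 : 0 < |(k : ℝ)| := by positivity
  have h1 : (|(k : ℝ)| ^ 3 * ‖c k‖) ^ 2 ≤ C ^ 2 := by
    gcongr
    exact hC k
  rw [← sq_abs (k : ℝ), ← (by decide : Even 4).pow_abs (k : ℝ), mul_one_div, le_div_iff₀ (by positivity)]
  calc _ = _ := by ring
    _ ≤ _ := h1

lemma IsGlobalSolution.memHs_two (hs : IsGlobalSolution ν h₀ h) (hν : 0 < ν) (h2 : MemHs 2 h₀)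
    {t : ℝ} (ht : 0 ≤ t) : MemHs 2 (h t) := by
  refine memHs_two_of_summable (hs.continuous_half.1 t ht).1 ?_
  rcases ht.eq_or_lt with rfl | ht
  · simpa only [hs.coeff_zero] using h2.summable_pow_four
  · obtain ⟨C, -, hC⟩ := hs.norm_coeff_le hν ht t
    exact (summable_inv_int_sq.mul_left (C ^ 2)).of_nonneg_of_le (fun k => by positivity)
      (pow_four_mul_sq_le_of_cubic_decay (hC t ⟨le_rfl, le_rfl⟩))

lemma IsGlobalSolution.energy_zero (hs : IsGlobalSolution ν h₀ h) :
    energy ν (h 0) = energy ν h₀ := by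
  rw [energy, energy, dx_congr_coeff hs.coeff_zero]

/-- The energy is continuous in time for positive times. -/
lemma IsGlobalSolution.continuousOn_energy (hs : IsGlobalSolution ν h₀ h) (hν : 0 < ν)
    (h2 : MemHs 2 h₀) : ContinuousOn (fun t => energy ν (h t)) (Set.Ioi 0) := by
  obtain ⟨U, hU, hUae, -⟩ := hs.exists_slope
  -- On compact time intervals away from `0`, the decay `|k|^{-3}` bounds the terms by `C²/k²`,
  -- uniformly in time.
  have hA : ContinuousOn (fun t => ∑' k : ℤ, (k : ℝ) ^ 4 * ‖coeff (h t) k‖ ^ 2) (Set.Ioi 0) := by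
    intro t ht
    have ht' : 0 < t := ht
    obtain ⟨C, -, hC⟩ := hs.norm_coeff_le hν (half_pos ht') (t + 1)
    have h1 : ContinuousOn (fun t => ∑' k : ℤ, (k : ℝ) ^ 4 * ‖coeff (h t) k‖ ^ 2)
        (Set.Icc (t / 2) (t + 1)) := by
      refine continuousOn_tsum (fun k s hs' => ?_) (summable_inv_int_sq.mul_left (C ^ 2))
        fun k s hs' => ?_
      · have := (hs.hasDerivAt_coeff k ((half_pos ht').trans_le hs'.1)).continuousAt
        exact (continuousAt_const.mul (this.norm.pow 2)).continuousWithinAt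
      · rw [Real.norm_of_nonneg (by positivity)]
        exact pow_four_mul_sq_le_of_cubic_decay (hC s hs') k
    exact (h1.continuousAt (Icc_mem_nhds (by linarith) (by linarith))).continuousWithinAt
  have hW : ContinuousOn (fun t => ∫ x, well (U t x)) (Set.Ioi 0) :=
    continuous_integral_well.comp_continuousOn hU
  refine ((hA.const_mul (ν / 2 * (2 * Real.pi))).add hW).congr fun t ht => ?_
  have hm := hs.memHs_two hν h2 (le_of_lt ht)
  simp only [hm.energy_eq, hm.hasSum_dx_dx.tsum_eq, Pi.add_apply]
  congr 1
  · field_simp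
  · refine integral_congr_ae ?_
    filter_upwards [hUae t ht] with x hx
    rw [hx]

end Solution

/-! ### The energy does not exceed its initial value: semiconvexity and a Gronwall argument. -/

section Energy

lemma MemHs.memLp_flux {f : Torus → ℝ} (hf : MemHs 2 f) : MemLp (flux f) 2 volume := by
  obtain ⟨w, hw⟩ := hf.exists_dx_ae_eq
  have h : MemLp ((w ^ 2 - 1) * w : C(Torus, ℝ)) 2 (volume : Measure Torus) :=
    MemLp.of_bound (ContinuousMap.continuous _).aestronglyMeasurable _
      (.of_forall fun x => ContinuousMap.norm_coe_le_norm _ x)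
  refine h.ae_eq ?_
  filter_upwards [hw] with x hx
  simp [flux, hx]

/-- Tangent-line inequality for the convex function `well p + p²/2 = (p⁴ + 1)/4`. The flux is the
derivative of `well`, and the quadratic term corrects for `well'' ≥ -1`. -/
lemma flux_mul_le (p q : ℝ) :
    (p ^ 2 - 1) * p * (q - p) ≤ well q - well p + 1 / 2 * (q - p) ^ 2 := by
  unfold well
  nlinarith [sq_nonneg (q ^ 2 - p ^ 2), sq_nonneg (p * (q - p))]

/-- Semiconvexity of the energy, with the subgradient inequality written on the Fourier side. -/
lemma tsum_conj_mul_le {ν : ℝ} (hν : 0 < ν) {f v : Torus → ℝ} (hf : MemHs 2 f) (hv : MemHs 2 v) :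
    2 * Real.pi * ∑' k : ℤ, (conj (coeff f k - coeff v k) *
        (-(ν * k ^ 4) * coeff f k + Complex.I * k * coeff (flux f) k)).re ≤
      energy ν v - energy ν f +
        2 * Real.pi * (1 / (8 * ν) * ∑' k, ‖coeff f k - coeff v k‖ ^ 2) := by
  have hD : MemLp (fun x => dx v x - dx f x) 2 volume := hv.memLp_dx.sub hf.memLp_dx
  have hDc : ∀ k, coeff (fun x => dx v x - dx f x) k = Complex.I * k * (coeff v k - coeff f k) := by
    intro k
    rw [coeff_sub hv.isWeakDeriv_dx.1 hf.isWeakDeriv_dx.1, hv.isWeakDeriv_dx.2,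
      hf.isWeakDeriv_dx.2]
    ring
  have A1 := hf.hasSum_dx_dx
  have A2 := hv.hasSum_dx_dx
  have A3 := hasSum_conj_coeff_mul_coeff hf.memLp_flux hD
  have A4 := hasSum_norm_sq_coeff hD
  have A5 : Summable fun k => ‖coeff f k - coeff v k‖ ^ 2 := by
    refine (hasSum_norm_sq_coeff (hf.1.sub hv.1)).summable.congr fun k => ?_
    rw [← coeff_sub (hf.1.integrable (by norm_num)) (hv.1.integrable (by norm_num))]
    rfl
  have A6 : Summable fun k : ℤ => (k : ℝ) ^ 4 * ‖coeff f k - coeff v k‖ ^ 2 := by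
    refine ((A1.summable.mul_left 2).add (A2.summable.mul_left 2)).of_nonneg_of_le
      (fun k => by positivity) fun k => ?_
    have h1 : ‖coeff f k - coeff v k‖ ^ 2 ≤ 2 * ‖coeff f k‖ ^ 2 + 2 * ‖coeff v k‖ ^ 2 := by
      have := norm_sub_le (coeff f k) (coeff v k)
      nlinarith [sq_nonneg (‖coeff f k‖ - ‖coeff v k‖), norm_nonneg (coeff f k - coeff v k)]
    have := mul_le_mul_of_nonneg_left h1 (by positivity : 0 ≤ (k : ℝ) ^ 4)
    linarith
  -- Polarisation of the bending term. Being quadratic, it leaves an exact negative remainder `-ν/2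
  -- k⁴ |f̂ - v̂|²`, available to absorb the concavity of the well.
  have hterm : ∀ k : ℤ, (conj (coeff f k - coeff v k) *
      (-(ν * k ^ 4) * coeff f k + Complex.I * k * coeff (flux f) k)).re =
      ν / 2 * ((k : ℝ) ^ 4 * ‖coeff v k‖ ^ 2 - (k : ℝ) ^ 4 * ‖coeff f k‖ ^ 2
        - (k : ℝ) ^ 4 * ‖coeff f k - coeff v k‖ ^ 2) +
      (conj (coeff (flux f) k) * coeff (fun x => dx v x - dx f x) k).re := by
    intro k
    rw [hDc]
    obtain ⟨k', hk'⟩ : ∃ r : ℝ, r = (k : ℝ) := ⟨_, rfl⟩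
    have hkc : (k : ℂ) = (k' : ℂ) := by rw [hk']; simp
    rw [hkc, ← hk', ← Complex.ofReal_pow, ← Complex.ofReal_mul]
    simp only [← Complex.normSq_eq_norm_sq, Complex.normSq_apply]
    simp only [Complex.mul_re, Complex.mul_im, Complex.add_re, Complex.add_im, Complex.sub_re,
      Complex.sub_im, Complex.conj_re, Complex.conj_im, Complex.I_re, Complex.I_im,
      Complex.ofReal_re, Complex.ofReal_im, Complex.neg_re, Complex.neg_im]
    ring
  have hS := ((((A2.sub A1).mul_left (ν / 2)).add A3).sub (A4.mul_left (1 / 2))).add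
    (A5.hasSum.mul_left (1 / (8 * ν)))
  have hT : Summable fun k : ℤ => (conj (coeff f k - coeff v k) *
      (-(ν * k ^ 4) * coeff f k + Complex.I * k * coeff (flux f) k)).re := by
    simp only [hterm]
    exact (((A2.summable.sub A1.summable).sub A6).mul_left _).add A3.summable
  have hle := hasSum_le (fun k => ?_) hT.hasSum hS
  · have h2π : 0 < 2 * Real.pi := Real.two_pi_pos
    refine (mul_le_mul_of_nonneg_left hle h2π.le).trans ?_
    obtain ⟨w, hw⟩ := hf.exists_dx_ae_eq
    obtain ⟨z, hz⟩ := hv.exists_dx_ae_eq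
    have hI1 := integrable_comp_of_ae_eq hw continuous_well
    have hI2 := integrable_comp_of_ae_eq hz continuous_well
    have hI3 : Integrable (fun x => flux f x * (dx v x - dx f x)) volume :=
      hf.memLp_flux.integrable_mul hD
    have hI4 : Integrable (fun x => (dx v x - dx f x) ^ 2) volume := hD.integrable_sq
    have hint : ∫ x, flux f x * (dx v x - dx f x) ≤ (∫ x, well (dx v x)) - (∫ x, well (dx f x)) +
        1 / 2 * ∫ x, (dx v x - dx f x) ^ 2 := by
      have hI21 : Integrable (fun x => well (dx v x) - well (dx f x)) volume := hI2.sub hI1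
      rw [← integral_const_mul, ← integral_sub hI2 hI1,
        ← integral_add hI21 (hI4.const_mul _)]
      exact integral_mono hI3 ((hI2.sub hI1).add (hI4.const_mul _)) fun x => flux_mul_le _ _
    rw [hf.energy_eq, hv.energy_eq]
    have hcancel : ∀ r : ℝ, 2 * Real.pi * ((2 * Real.pi)⁻¹ * r) = r := fun r =>
      mul_inv_cancel_left₀ h2π.ne' r
    linear_combination hint + (ν / 2) * hcancel (∫ x, dx (dx v) x ^ 2) -
      (ν / 2) * hcancel (∫ x, dx (dx f) x ^ 2) + hcancel (∫ x, flux f x * (dx v x - dx f x)) -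
      1 / 2 * hcancel (∫ x, (dx v x - dx f x) ^ 2)
  · rw [hterm]
    have h1 : ‖coeff (fun x => dx v x - dx f x) k‖ ^ 2 =
        (k : ℝ) ^ 2 * ‖coeff f k - coeff v k‖ ^ 2 := by
      rw [hDc, norm_mul, mul_pow, norm_sub_rev]
      simp
    rw [h1]
    -- Interpolation of `H¹` between `L²` and `H²`. Completing the square fixes the constant
    -- `1/(8ν)`.
    have h2 : 1 / 2 * (k : ℝ) ^ 2 ≤ ν / 2 * (k : ℝ) ^ 4 + 1 / (8 * ν) := by
      have h3 : ν / 2 * (k : ℝ) ^ 4 + 1 / (8 * ν) - 1 / 2 * (k : ℝ) ^ 2 =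
          (2 * ν * (k : ℝ) ^ 2 - 1) ^ 2 / (8 * ν) := by
        field_simp; ring
      have : 0 ≤ (2 * ν * (k : ℝ) ^ 2 - 1) ^ 2 / (8 * ν) := by positivity
      linarith
    have := mul_le_mul_of_nonneg_right h2 (sq_nonneg ‖coeff f k - coeff v k‖)
    linarith

variable {ν : ℝ} {h₀ : Torus → ℝ} {h : ℝ → Torus → ℝ}

/-- Termwise differentiation of Parseval's sum. Near `t` the derivative of the `k`-th coefficient is
`O(|k|)`, while `|k| |ĥ(k)| = O(k^{-2})` and `|k| |v̂(k)|` is summable because `v ∈ H²`. -/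
lemma IsGlobalSolution.hasDerivAt_dist_sq (hs : IsGlobalSolution ν h₀ h) (hν : 0 < ν)
    (h2 : MemHs 2 h₀) {v : Torus → ℝ} (hv : MemHs 2 v) {t : ℝ} (ht : 0 < t) :
    HasDerivAt (fun s => ∑' k, ‖coeff (h s) k - coeff v k‖ ^ 2)
      (2 * ∑' k : ℤ, (conj (coeff (h t) k - coeff v k) *
        (-(ν * k ^ 4) * coeff (h t) k + Complex.I * k * coeff (flux (h t)) k)).re) t := by
  have ht2 : 0 < t / 2 := half_pos ht
  obtain ⟨B, hB0, hB⟩ := hs.norm_coeff_flux_le_of_pos ht2 (t + 1)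
  obtain ⟨C, hC0, hC⟩ := hs.norm_coeff_le hν ht2 (t + 1)
  have hsum : Summable fun k : ℤ => 2 * (ν * C + B) * (C * (1 / (k : ℝ) ^ 2) +
      |(k : ℝ)| * ‖coeff v k‖) :=
    ((summable_inv_int_sq.mul_left C).add hv.summable_abs).mul_left _
  have htm : t ∈ Set.Ioo (t / 2) (t + 1) := ⟨by linarith, by linarith⟩
  rw [← tsum_mul_left]
  refine hasDerivAt_tsum_of_isPreconnected (t := Set.Ioo (t / 2) (t + 1)) (y₀ := t)
    (g' := fun k s => 2 * (conj (coeff (h s) k - coeff v k) *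
        (-(ν * k ^ 4) * coeff (h s) k + Complex.I * k * coeff (flux (h s)) k)).re) hsum isOpen_Ioo
    isPreconnected_Ioo (fun k s hs' => ?_) (fun k s hs' => ?_) htm ?_ htm
  · have := ((hs.hasDerivAt_coeff k (ht2.trans hs'.1)).sub_const (coeff v k)).norm_sq
    rwa [Complex.inner, mul_comm (_ + _)] at this
  · have hs'' := Set.Ioo_subset_Icc_self hs'
    have hCk := hC s hs'' k
    have hBk := hB s hs'' k
    have h1 : ‖-(ν * k ^ 4 : ℂ) * coeff (h s) k + Complex.I * k * coeff (flux (h s)) k‖ ≤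
        (ν * C + B) * |(k : ℝ)| := by
      refine (norm_add_le _ _).trans ?_
      simp only [norm_mul, norm_neg, Complex.norm_real, Complex.norm_I, one_mul, norm_pow,
        Complex.norm_intCast, Real.norm_of_nonneg hν.le]
      have h3 : ν * |(k : ℝ)| * (|(k : ℝ)| ^ 3 * ‖coeff (h s) k‖) ≤ ν * |(k : ℝ)| * C := by gcongr
      have h4 : |(k : ℝ)| * ‖coeff (flux (h s)) k‖ ≤ |(k : ℝ)| * B := by gcongr
      linarith
    have h2 : |(k : ℝ)| * ‖coeff (h s) k‖ ≤ C * (1 / (k : ℝ) ^ 2) := by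
      rcases eq_or_ne k 0 with rfl | hk
      · simp
      have hk0 : 0 < |(k : ℝ)| := by positivity
      rw [← sq_abs (k : ℝ), mul_one_div, le_div_iff₀ (by positivity)]
      linarith
    rw [norm_mul, Real.norm_ofNat, mul_assoc 2, Real.norm_eq_abs]
    refine mul_le_mul_of_nonneg_left ?_ zero_le_two
    refine (Complex.abs_re_le_norm _).trans ?_
    rw [norm_mul, RCLike.norm_conj]
    have hK : 0 ≤ ν * C + B := by positivity
    refine (mul_le_mul (norm_sub_le _ _) h1 (norm_nonneg _) (by positivity)).trans ?_
    calc _ = (ν * C + B) * (|(k : ℝ)| * ‖coeff (h s) k‖ + |(k : ℝ)| * ‖coeff v k‖) := by ring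
      _ ≤ _ := by gcongr
  · have hm := hs.memHs_two hν h2 ht.le
    refine (hasSum_norm_sq_coeff (hm.1.sub hv.1)).summable.congr fun k => ?_
    rw [← coeff_sub (hm.1.integrable (by norm_num)) (hv.1.integrable (by norm_num))]
    rfl

/-- The `L²` distance is dominated by the `H^{1/2}` one. The case that matters is `a = 0`, where the
differentiated equation is not available. -/
lemma IsGlobalSolution.tendsto_dist_sq (hs : IsGlobalSolution ν h₀ h) {a : ℝ} (ha : 0 ≤ a) :
    Tendsto (fun s => ∑' k, ‖coeff (h s) k - coeff (h a) k‖ ^ 2) (𝓝[Set.Ici 0] a) (𝓝 0) := by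
  have h1 := hs.continuous_half.2 a ha
  have h2 : Tendsto (fun s => (hsNormSq (1 / 2) fun x => h s x - h a x).toReal)
      (𝓝[Set.Ici 0] a) (𝓝 0) := by
    exact (ENNReal.tendsto_toReal ENNReal.zero_ne_top).comp h1
  refine squeeze_zero' (.of_forall fun s => tsum_nonneg fun k => by positivity) ?_ h2
  filter_upwards [h1.eventually_lt_const ENNReal.zero_lt_top, self_mem_nhdsWithin] with s hfin hs0
  have hm := (hs.continuous_half.1 s hs0).1
  have hma := (hs.continuous_half.1 a ha).1
  have hsum := hsNormSq_lt_top_iff.1 hfin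
  have hc := coeff_sub (hm.integrable (by norm_num)) (hma.integrable (by norm_num))
  rw [hsNormSq, ENNReal.tsum_toReal_eq (fun k => ENNReal.ofReal_ne_top)]
  have hle : ∀ k : ℤ, ‖coeff (h s) k - coeff (h a) k‖ ^ 2 ≤
      (1 + |(k : ℝ)| ^ (2 * (1 / 2) : ℝ)) * ‖coeff (fun x => h s x - h a x) k‖ ^ 2 := fun k => by
    rw [hc]
    refine le_mul_of_one_le_left (sq_nonneg _) ?_
    linarith [Real.rpow_nonneg (abs_nonneg (k : ℝ)) (2 * (1 / 2))]
  have heq : ∀ k : ℤ, (ENNReal.ofReal ((1 + |(k : ℝ)| ^ (2 * (1 / 2) : ℝ)) *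
      ‖coeff (fun x => h s x - h a x) k‖ ^ 2)).toReal = (1 + |(k : ℝ)| ^ (2 * (1 / 2) : ℝ)) *
      ‖coeff (fun x => h s x - h a x) k‖ ^ 2 := fun k => ENNReal.toReal_ofReal (by positivity)
  simp only [heq]
  exact (hsum.of_nonneg_of_le (fun k => by positivity) hle).tsum_le_tsum hle hsum

/-- The energy cannot stay above its value at time `a` on a whole interval `(a, b]`. -/
lemma IsGlobalSolution.exists_energy_le (hs : IsGlobalSolution ν h₀ h) (hν : 0 < ν)
    (h2 : MemHs 2 h₀) {a b : ℝ} (ha : 0 ≤ a) (hab : a < b) :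
    ∃ s ∈ Set.Ioc a b, energy ν (h s) ≤ energy ν (h a) := by
  by_contra! hcon
  set y : ℝ → ℝ := fun s => ∑' k, ‖coeff (h s) k - coeff (h a) k‖ ^ 2 with hy
  have hya : y a = 0 := by simp [hy]
  have hv := hs.memHs_two hν h2 ha
  have hder : ∀ s, a < s → HasDerivAt y (2 * ∑' k : ℤ, (conj (coeff (h s) k - coeff (h a) k) *
      (-(ν * k ^ 4) * coeff (h s) k + Complex.I * k * coeff (flux (h s)) k)).re) s := fun s hs' =>
    hs.hasDerivAt_dist_sq hν h2 hv (ha.trans_lt hs')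
  have hcont : ContinuousOn y (Set.Icc a b) := by
    intro s hs'
    rcases hs'.1.eq_or_lt with rfl | hlt
    · have : ContinuousWithinAt y (Set.Ici 0) a := by
        rw [ContinuousWithinAt, hya]
        exact hs.tendsto_dist_sq ha
      exact this.mono fun r hr => ha.trans hr.1
    · exact (hder s hlt).continuousAt.continuousWithinAt
  -- Semiconvexity and the assumed strict excess of energy give `y' < y/(4ν)`; the exponential is
  -- the integrating factor.
  have hanti : StrictAntiOn (fun s => Real.exp (-(1 / (4 * ν)) * s) * y s) (Set.Icc a b) := by
    refine strictAntiOn_of_deriv_neg (convex_Icc a b)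
      (ContinuousOn.mul (by fun_prop) hcont) fun s hs' => ?_
    rw [interior_Icc] at hs'
    have hE : HasDerivAt (fun s : ℝ => Real.exp (-(1 / (4 * ν)) * s))
        (Real.exp (-(1 / (4 * ν)) * s) * (-(1 / (4 * ν)))) s := by
      simpa using ((hasDerivAt_id s).const_mul (-(1 / (4 * ν)))).exp
    rw [(hE.fun_mul (hder s hs'.1)).deriv]
    have hevi := tsum_conj_mul_le hν (hs.memHs_two hν h2 (ha.trans hs'.1.le)) hv
    have hlt := hcon s ⟨hs'.1, hs'.2.le⟩
    set S := ∑' k : ℤ, (conj (coeff (h s) k - coeff (h a) k) *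
      (-(ν * k ^ 4) * coeff (h s) k + Complex.I * k * coeff (flux (h s)) k)).re
    have h3 : 2 * Real.pi * S < 2 * Real.pi * (1 / (8 * ν) * y s) := by linarith
    have h4 := lt_of_mul_lt_mul_left h3 Real.two_pi_pos.le
    have h5 : 1 / (4 * ν) * y s = 2 * (1 / (8 * ν) * y s) := by field_simp; ring
    have h6 : 2 * S - 1 / (4 * ν) * y s < 0 := by linarith
    have := mul_neg_of_pos_of_neg (Real.exp_pos (-(1 / (4 * ν)) * s)) h6
    linarith
  have hlt := hanti ⟨le_rfl, hab.le⟩ ⟨hab.le, le_rfl⟩ hab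
  simp only [hya, mul_zero] at hlt
  have : 0 ≤ y b := tsum_nonneg fun k => by positivity
  have := mul_nonneg (Real.exp_pos (-(1 / (4 * ν)) * b)).le this
  linarith

/-- The energy of a solution is at most its initial energy. -/
lemma IsGlobalSolution.energy_le (hs : IsGlobalSolution ν h₀ h) (hν : 0 < ν) (h2 : MemHs 2 h₀)
    {t : ℝ} (ht : 0 ≤ t) : energy ν (h t) ≤ energy ν h₀ := by
  rw [← hs.energy_zero]
  rcases ht.eq_or_lt with rfl | ht
  · rfl
  -- Continuity of the energy is known only at positive times, so the comparison first moves from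
  -- `0` to some `s > 0`.
  obtain ⟨s, hs', hle⟩ := hs.exists_energy_le hν h2 le_rfl ht
  refine le_trans ?_ hle
  -- the last time in `[s, t]` at which the energy is at most its value at time `s`
  set K := {r ∈ Set.Icc s t | energy ν (h r) ≤ energy ν (h s)} with hK
  have hKc : IsCompact K := by
    have hc : ContinuousOn (fun t => energy ν (h t)) (Set.Icc s t) :=
      (hs.continuousOn_energy hν h2).mono fun r hr => hs'.1.trans_le hr.1
    exact isCompact_Icc.of_isClosed_subset
      (hc.preimage_isClosed_of_isClosed isClosed_Icc isClosed_Iic) (Set.sep_subset _ _)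
  obtain ⟨r, ⟨hr, hrE⟩, hrmax⟩ := hKc.exists_isGreatest ⟨s, ⟨le_rfl, hs'.2⟩, le_rfl⟩
  rcases hr.2.eq_or_lt with rfl | hrt
  · exact hrE
  obtain ⟨q, hq, hqE⟩ := hs.exists_energy_le hν h2 (hs'.1.le.trans hr.1) hrt
  have := hrmax ⟨⟨hr.1.trans hq.1.le, hq.2⟩, hqE.trans hrE⟩
  exact absurd hq.1 (not_lt.2 this)

end Energy

/-! ### A regularised sawtooth of energy `O(√ν)`. -/

section Datum

/-- A classical derivative on the circle is a weak derivative. -/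
lemma isWeakDeriv_of_hasDerivAt {F G : Torus → ℝ}
    (hF : ∀ x : ℝ, HasDerivAt (fun z : ℝ => F z) (G x) x) (hG : Continuous G) :
    IsWeakDeriv F G := by
  refine ⟨integrable_continuous hG, fun k => ?_⟩
  have hmk : Continuous fun z : ℝ => (z : Torus) := AddCircle.continuous_mk' _
  have hG' : Continuous fun z : ℝ => G z := hG.comp hmk
  have hF' : Continuous fun z : ℝ => F z :=
    continuous_iff_continuousAt.2 fun x => (hF x).continuousAt
  have he : Continuous fun z : ℝ => (fourier (-k) (z : Torus) : ℂ) :=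
    (fourier (-k)).continuous.comp hmk
  have hder : ∀ x : ℝ, HasDerivAt (fun z : ℝ => fourier (-k) (z : Torus) * (F z : ℂ))
      (fourier (-k) (x : Torus) * (G x : ℂ) -
        Complex.I * k * (fourier (-k) (x : Torus) * (F x : ℂ))) x := by
    intro x
    refine ((hasDerivAt_fourier_neg (2 * Real.pi) k x).mul (hF x).ofReal_comp).congr_deriv ?_
    have : (2 * Real.pi : ℂ) ≠ 0 := by exact_mod_cast Real.two_pi_pos.ne'
    push_cast
    field_simp
    ring
  have h1 : Continuous fun z : ℝ => fourier (-k) (z : Torus) * (G z : ℂ) := by fun_prop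
  have h2 : Continuous fun z : ℝ => Complex.I * k * (fourier (-k) (z : Torus) * (F z : ℂ)) :=
    continuous_const.mul (he.mul (Complex.continuous_ofReal.comp hF'))
  have hftc := intervalIntegral.integral_eq_sub_of_hasDerivAt (a := 0) (b := 0 + 2 * Real.pi)
    (fun x _ => hder x) ((h1.sub h2).intervalIntegrable _ _)
  have hper : ((0 + 2 * Real.pi : ℝ) : Torus) = ((0 : ℝ) : Torus) := by
    simp
  rw [hper, sub_self, intervalIntegral.integral_sub (h1.intervalIntegrable _ _)
    (h2.intervalIntegrable _ _), intervalIntegral.integral_const_mul, sub_eq_zero] at hftc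
  rw [coeff, coeff, fourierCoeff_eq_intervalIntegral _ _ 0, fourierCoeff_eq_intervalIntegral _ _ 0]
  simp only [smul_eq_mul]
  rw [hftc, mul_smul_comm]

variable {F G K : Torus → ℝ}

lemma memHs_two_of_hasDerivAt (hF : Continuous F)
    (hFG : ∀ x : ℝ, HasDerivAt (fun z : ℝ => F z) (G x) x) (hG : Continuous G)
    (hGK : ∀ x : ℝ, HasDerivAt (fun z : ℝ => G z) (K x) x) (hK : Continuous K) : MemHs 2 F := by
  have hmem : ∀ {f : Torus → ℝ}, Continuous f → MemLp f 2 volume := fun {f} hf =>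
    MemLp.of_bound hf.aestronglyMeasurable ‖(⟨f, hf⟩ : C(Torus, ℝ))‖
      (.of_forall fun x => ContinuousMap.norm_coe_le_norm ⟨f, hf⟩ x)
  refine memHs_two_of_summable (hmem hF) ((hasSum_norm_sq_coeff (hmem hK)).summable.congr fun k => ?_)
  rw [(isWeakDeriv_of_hasDerivAt hGK hK).2, (isWeakDeriv_of_hasDerivAt hFG hG).2]
  simp only [norm_mul, Complex.norm_I, one_mul, Complex.norm_intCast, mul_pow, sq_abs]
  ring

lemma energy_eq_of_hasDerivAt (ν : ℝ)
    (hFG : ∀ x : ℝ, HasDerivAt (fun z : ℝ => F z) (G x) x) (hG : Continuous G)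
    (hGK : ∀ x : ℝ, HasDerivAt (fun z : ℝ => G z) (K x) x) (hK : Continuous K) :
    energy ν F = ∫ x, (1 / 2 * ν * K x ^ 2 + well (G x)) := by
  have h1 := isWeakDeriv_of_hasDerivAt hFG hG
  have h2 : dx (dx F) =ᵐ[volume] K := by
    rw [dx_congr_coeff fun k => coeff_congr_ae h1.dx_ae_eq k]
    exact (isWeakDeriv_of_hasDerivAt hGK hK).dx_ae_eq
  refine integral_congr_ae ?_
  filter_upwards [h1.dx_ae_eq, h2] with x hx1 hx2
  rw [hx1, hx2, well]

lemma continuous_periodic_lift {f : ℝ → ℝ} (hf : Function.Periodic f (2 * Real.pi))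
    (hc : Continuous f) : Continuous (hf.lift : Torus → ℝ) :=
  continuous_coinduced_dom.2 hc

variable {ε : ℝ}

/-- A smooth periodic sawtooth whose slope is a regularised sign of `sin`. -/
def sawtooth (ε x : ℝ) : ℝ := -Real.arcsin (Real.cos x / √(1 + ε ^ 2))

/-- The slope of the sawtooth. -/
def sawtoothSlope (ε x : ℝ) : ℝ := Real.sin x / √(Real.sin x ^ 2 + ε ^ 2)

/-- The curvature of the sawtooth. -/
def sawtoothCurv (ε x : ℝ) : ℝ := ε ^ 2 * Real.cos x / √(Real.sin x ^ 2 + ε ^ 2) ^ 3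

lemma sin_sq_add_pos (hε : 0 < ε) (x : ℝ) : 0 < Real.sin x ^ 2 + ε ^ 2 := by positivity

lemma hasDerivAt_sawtooth (hε : 0 < ε) (x : ℝ) :
    HasDerivAt (sawtooth ε) (sawtoothSlope ε x) x := by
  set q := √(1 + ε ^ 2) with hq
  have hq2 : q ^ 2 = 1 + ε ^ 2 := Real.sq_sqrt (by positivity)
  have hq0 : 0 < q := Real.sqrt_pos.2 (by positivity)
  have hA := sin_sq_add_pos hε x
  have hsq : 1 - (Real.cos x / q) ^ 2 = (Real.sin x ^ 2 + ε ^ 2) / q ^ 2 := by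
    rw [div_pow, eq_div_iff (by positivity), sub_mul, div_mul_cancel₀ _ (by positivity), hq2]
    linarith [Real.sin_sq_add_cos_sq x]
  have hpos : 0 < 1 - (Real.cos x / q) ^ 2 := by rw [hsq]; positivity
  have h1 : Real.cos x / q ≠ -1 := by intro h; rw [h] at hpos; norm_num at hpos
  have h2 : Real.cos x / q ≠ 1 := by intro h; rw [h] at hpos; norm_num at hpos
  have hd := ((Real.hasDerivAt_arcsin h1 h2).comp x ((Real.hasDerivAt_cos x).div_const q)).neg
  refine hd.congr_deriv ?_
  rw [hsq, Real.sqrt_div' _ (by positivity), Real.sqrt_sq hq0.le, sawtoothSlope]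
  have : 0 < √(Real.sin x ^ 2 + ε ^ 2) := Real.sqrt_pos.2 hA
  field_simp

lemma hasDerivAt_sawtoothSlope (hε : 0 < ε) (x : ℝ) :
    HasDerivAt (sawtoothSlope ε) (sawtoothCurv ε x) x := by
  have hA := sin_sq_add_pos hε x
  have hS : 0 < √(Real.sin x ^ 2 + ε ^ 2) := Real.sqrt_pos.2 hA
  have hS2 : √(Real.sin x ^ 2 + ε ^ 2) ^ 2 = Real.sin x ^ 2 + ε ^ 2 := Real.sq_sqrt hA.le
  have hd := (Real.hasDerivAt_sin x).div
    ((((Real.hasDerivAt_sin x).pow 2).add_const (ε ^ 2)).sqrt hA.ne') hS.ne'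
  refine hd.congr_deriv ?_
  simp only [Pi.pow_apply]
  set S := √(Real.sin x ^ 2 + ε ^ 2) with hSdef
  rw [sawtoothCurv, ← hSdef]
  field_simp
  rw [hS2]
  norm_num
  ring

lemma continuous_sawtoothCurv (hε : 0 < ε) : Continuous (sawtoothCurv ε) := by
  unfold sawtoothCurv
  refine Continuous.div (by fun_prop) (by fun_prop) fun x => ?_
  have : 0 < √(Real.sin x ^ 2 + ε ^ 2) := Real.sqrt_pos.2 (sin_sq_add_pos hε x)
  positivity

/-- The energy density of the sawtooth. -/
lemma sawtooth_density_le (hε : 0 < ε) (x : ℝ) :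
    1 / 2 * ε ^ 2 * sawtoothCurv ε x ^ 2 + well (sawtoothSlope ε x) ≤
      3 / 4 * ε * (ε * |Real.cos x| / (Real.sin x ^ 2 + ε ^ 2)) + ε ^ 2 / 4 := by
  have hA := sin_sq_add_pos hε x
  have hS2 : √(Real.sin x ^ 2 + ε ^ 2) ^ 2 = Real.sin x ^ 2 + ε ^ 2 := Real.sq_sqrt hA.le
  have hsc := Real.sin_sq_add_cos_sq x
  have hc1 : Real.cos x ^ 2 ≤ |Real.cos x| := by
    rw [← sq_abs]
    nlinarith [Real.abs_cos_le_one x, abs_nonneg (Real.cos x)]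
  set A := Real.sin x ^ 2 + ε ^ 2 with hAdef
  have hK : sawtoothCurv ε x ^ 2 = ε ^ 4 * Real.cos x ^ 2 / A ^ 3 := by
    have h6 : (√A ^ 3) ^ 2 = A ^ 3 := by rw [← pow_mul, mul_comm 3 2, pow_mul, hS2]
    rw [sawtoothCurv, div_pow, h6]
    ring
  have hG : sawtoothSlope ε x ^ 2 = Real.sin x ^ 2 / A := by
    rw [sawtoothSlope, div_pow, hS2]
  have hW : well (sawtoothSlope ε x) = 1 / 4 * (ε ^ 4 / A ^ 2) := by
    rw [well, hG]
    have : Real.sin x ^ 2 = A - ε ^ 2 := by rw [hAdef]; ring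
    rw [this]
    field_simp
    ring
  have hεA : ε ^ 2 ≤ A := by rw [hAdef]; nlinarith [sq_nonneg (Real.sin x)]
  have hε4 : ε ^ 4 ≤ A ^ 2 := by
    calc ε ^ 4 = (ε ^ 2) ^ 2 := by ring
      _ ≤ A ^ 2 := by gcongr
  have h1 : sawtoothCurv ε x ^ 2 ≤ |Real.cos x| / A := by
    rw [hK, div_le_div_iff₀ (by positivity) hA]
    calc ε ^ 4 * Real.cos x ^ 2 * A ≤ A ^ 2 * |Real.cos x| * A := by gcongr
      _ = |Real.cos x| * A ^ 3 := by ring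
  -- Splitting `ε⁴` by `cos² + sin² = 1` produces a factor `|cos|` near the corners, where `|cos x|
  -- / A` has an explicit antiderivative. The `sin²` part is harmless because `sin² ≤ A`.
  have h2 : ε ^ 4 / A ^ 2 ≤ ε ^ 2 * (|Real.cos x| / A) + ε ^ 2 := by
    have h3 : ε ^ 2 * (|Real.cos x| / A) + ε ^ 2 = (ε ^ 2 * |Real.cos x| * A + ε ^ 2 * A ^ 2) / A ^ 2 := by
      field_simp
    rw [h3]
    gcongr
    have h4 : ε ^ 4 * Real.cos x ^ 2 ≤ ε ^ 2 * |Real.cos x| * A := by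
      calc ε ^ 4 * Real.cos x ^ 2 = ε ^ 2 * Real.cos x ^ 2 * ε ^ 2 := by ring
        _ ≤ _ := by gcongr
    have h5 : ε ^ 4 * Real.sin x ^ 2 ≤ ε ^ 2 * A ^ 2 := by
      have h6 : Real.sin x ^ 2 ≤ A := by rw [hAdef]; nlinarith [sq_nonneg ε]
      calc ε ^ 4 * Real.sin x ^ 2 = ε ^ 2 * (ε ^ 2 * Real.sin x ^ 2) := by ring
        _ ≤ ε ^ 2 * (A * A) := by gcongr
        _ = _ := by ring
    calc ε ^ 4 = ε ^ 4 * Real.cos x ^ 2 + ε ^ 4 * Real.sin x ^ 2 := by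
          rw [← mul_add, add_comm (Real.cos x ^ 2), hsc, mul_one]
      _ ≤ _ := add_le_add h4 h5
  rw [hW]
  have h7 := mul_le_mul_of_nonneg_left h1 (by positivity : 0 ≤ 1 / 2 * ε ^ 2)
  have h8 : 3 / 4 * ε * (ε * |Real.cos x| / A) = 3 / 4 * ε ^ 2 * (|Real.cos x| / A) := by ring
  rw [h8]
  linarith

/-- The function `ε cos x / (sin² x + ε²)` is the derivative of `arctan (sin x / ε)`. Where `cos`
has constant sign `σ`, the integral of its absolute value is therefore at most `π`, whatever `ε`. -/
lemma integral_sawtooth_density_le (hε : 0 < ε) {a b σ : ℝ} (hab : a ≤ b) (hσ : |σ| = 1)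
    (hcos : ∀ x ∈ Set.Icc a b, 0 ≤ σ * Real.cos x) :
    ∫ x in a..b, (1 / 2 * ε ^ 2 * sawtoothCurv ε x ^ 2 + well (sawtoothSlope ε x)) ≤
      3 / 4 * ε * Real.pi + ε ^ 2 / 4 * (b - a) := by
  have hder : ∀ x, HasDerivAt (fun x => 3 / 4 * ε * (σ * Real.arctan (Real.sin x / ε)) +
      ε ^ 2 / 4 * x) (3 / 4 * ε * (ε * (σ * Real.cos x) / (Real.sin x ^ 2 + ε ^ 2)) + ε ^ 2 / 4) x := by
    intro x
    have hA := sin_sq_add_pos hε x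
    refine ((((((Real.hasDerivAt_sin x).div_const ε).arctan).const_mul σ).const_mul
      (3 / 4 * ε)).add ((hasDerivAt_id x).const_mul (ε ^ 2 / 4))).congr_deriv ?_
    have : 1 + (Real.sin x / ε) ^ 2 = (Real.sin x ^ 2 + ε ^ 2) / ε ^ 2 := by
      field_simp; ring
    rw [this]
    field_simp
  have hc1 : Continuous fun x => 1 / 2 * ε ^ 2 * sawtoothCurv ε x ^ 2 + well (sawtoothSlope ε x) := by
    have h1 := continuous_sawtoothCurv hε
    have h2 : Continuous (sawtoothSlope ε) :=
      continuous_iff_continuousAt.2 fun x => (hasDerivAt_sawtoothSlope hε x).continuousAt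
    fun_prop
  have hc2 : Continuous fun x =>
      3 / 4 * ε * (ε * (σ * Real.cos x) / (Real.sin x ^ 2 + ε ^ 2)) + ε ^ 2 / 4 := by
    refine Continuous.add (continuous_const.mul (Continuous.div (by fun_prop) (by fun_prop)
      fun x => (sin_sq_add_pos hε x).ne')) continuous_const
  have hftc := intervalIntegral.integral_eq_sub_of_hasDerivAt (a := a) (b := b)
    (fun x _ => hder x) (hc2.intervalIntegrable _ _)
  calc _ ≤ ∫ x in a..b, (3 / 4 * ε * (ε * (σ * Real.cos x) / (Real.sin x ^ 2 + ε ^ 2)) + ε ^ 2 / 4) := by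
        refine intervalIntegral.integral_mono_on hab (hc1.intervalIntegrable _ _)
          (hc2.intervalIntegrable _ _) fun x hx => (sawtooth_density_le hε x).trans_eq ?_
        rw [← abs_of_nonneg (hcos x hx), abs_mul, hσ, one_mul]
    _ ≤ _ := by
        rw [hftc]
        have h1 : ∀ x, |σ * Real.arctan (Real.sin x / ε)| ≤ Real.pi / 2 := fun x => by
          rw [abs_mul, hσ, one_mul, abs_le]
          exact ⟨(Real.neg_pi_div_two_lt_arctan _).le, (Real.arctan_lt_pi_div_two _).le⟩
        have h2 := (abs_le.1 (h1 b)).2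
        have h3 := (abs_le.1 (h1 a)).1
        have h4 := mul_le_mul_of_nonneg_left (by linarith : σ * Real.arctan (Real.sin b / ε) -
          σ * Real.arctan (Real.sin a / ε) ≤ Real.pi) (by positivity : 0 ≤ 3 / 4 * ε)
        linarith

lemma integral_sawtooth_energy_le (hε : 0 < ε) :
    ∫ x in (-(Real.pi / 2))..(-(Real.pi / 2) + 2 * Real.pi),
      (1 / 2 * ε ^ 2 * sawtoothCurv ε x ^ 2 + well (sawtoothSlope ε x)) ≤
      3 / 2 * Real.pi * ε + Real.pi / 2 * ε ^ 2 := by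
  have hπ := Real.pi_pos
  have hc1 : Continuous fun x => 1 / 2 * ε ^ 2 * sawtoothCurv ε x ^ 2 + well (sawtoothSlope ε x) := by
    have h1 := continuous_sawtoothCurv hε
    have h2 : Continuous (sawtoothSlope ε) :=
      continuous_iff_continuousAt.2 fun x => (hasDerivAt_sawtoothSlope hε x).continuousAt
    fun_prop
  -- Starting the period at `-π/2` splits it into two halves on each of which `cos` has constant
  -- sign.
  rw [← intervalIntegral.integral_add_adjacent_intervals (b := Real.pi / 2)
    (hc1.intervalIntegrable _ _) (hc1.intervalIntegrable _ _)]
  have h1 := integral_sawtooth_density_le hε (a := -(Real.pi / 2)) (b := Real.pi / 2) (σ := 1)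
    (by linarith) (by simp) fun x hx => by
      rw [one_mul]; exact Real.cos_nonneg_of_mem_Icc hx
  have h2 := integral_sawtooth_density_le hε (a := Real.pi / 2) (b := -(Real.pi / 2) + 2 * Real.pi)
    (σ := -1) (by linarith) (by simp) fun x hx => by
      have := Real.cos_nonpos_of_pi_div_two_le_of_le hx.1 (by linarith [hx.2])
      linarith
  linarith

/-- For every `ν > 0` there is a datum of energy `O(√ν + ν)`. -/
lemma exists_isDatum_energy_le {ν : ℝ} (hν : 0 < ν) :
    ∃ f : Torus → ℝ, IsDatum f ∧
      energy ν f ≤ 3 / 2 * Real.pi * √ν + Real.pi / 2 * ν := by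
  -- This corner width balances the bending energy, of order `ν/ε`, against the well energy, of
  -- order `ε`.
  set ε := √ν with hεdef
  have hε : 0 < ε := Real.sqrt_pos.2 hν
  have hεν : ε ^ 2 = ν := Real.sq_sqrt hν.le
  have p0 : Function.Periodic (sawtooth ε) (2 * Real.pi) := fun x => by simp [sawtooth]
  have p1 : Function.Periodic (sawtoothSlope ε) (2 * Real.pi) := fun x => by simp [sawtoothSlope]
  have p2 : Function.Periodic (sawtoothCurv ε) (2 * Real.pi) := fun x => by simp [sawtoothCurv]
  let F : Torus → ℝ := p0.lift
  let G : Torus → ℝ := p1.lift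
  let K : Torus → ℝ := p2.lift
  have hFG : ∀ x : ℝ, HasDerivAt (fun z : ℝ => F z) (G x) x := hasDerivAt_sawtooth hε
  have hGK : ∀ x : ℝ, HasDerivAt (fun z : ℝ => G z) (K x) x := hasDerivAt_sawtoothSlope hε
  have hF : Continuous F := continuous_periodic_lift p0
    (continuous_iff_continuousAt.2 fun x => (hasDerivAt_sawtooth hε x).continuousAt)
  have hG : Continuous G := continuous_periodic_lift p1
    (continuous_iff_continuousAt.2 fun x => (hasDerivAt_sawtoothSlope hε x).continuousAt)
  have hK : Continuous K := continuous_periodic_lift p2 (continuous_sawtoothCurv hε)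
  refine ⟨F, ⟨memHs_two_of_hasDerivAt hF hFG hG hGK hK, ?_⟩, ?_⟩
  -- Antisymmetry under a half-period shift forces mean zero.
  · have hanti : ∀ x : Torus, F (x + (Real.pi : Torus)) = -F x := by
      intro x
      obtain ⟨X, rfl⟩ := QuotientAddGroup.mk_surjective x
      change sawtooth ε (X + Real.pi) = -sawtooth ε X
      simp [sawtooth, neg_div, Real.arcsin_neg]
    have h1 := integral_add_right_eq_self (μ := (volume : Measure Torus)) F (Real.pi : Torus)
    simp only [hanti, integral_neg] at h1
    linarith
  · rw [energy_eq_of_hasDerivAt ν hFG hG hGK hK,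
      ← AddCircle.intervalIntegral_preimage (2 * Real.pi) (-(Real.pi / 2))]
    have := integral_sawtooth_energy_le hε
    rw [hεν] at this
    exact this

end Datum

end ThinFilm

end

/-! ### The main theorem. -/

theorem proposition5p1 (ν₀ : ℝ) (hν₀ : 0 < ν₀) :
    (∃ C₁ : ℝ, 0 < C₁ ∧ ∀ ν : ℝ, 0 < ν → ν ≤ ν₀ →
      ∀ h₀ : ThinFilm.Torus → ℝ, ThinFilm.IsDatum h₀ →
      ∀ h : ℝ → ThinFilm.Torus → ℝ, ThinFilm.IsGlobalSolution ν h₀ h →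
      ∀ t : ℝ, 0 ≤ t →
        ThinFilm.gradSup (h t) ≤
          ENNReal.ofReal
            (C₁ * max 1 (ν ^ (-(1 / 6) : ℝ) * ThinFilm.energy ν h₀ ^ (1 / 3 : ℝ)))) ∧
    (∃ C₂ B₁ : ℝ, 0 < C₂ ∧ 0 < B₁ ∧ ∀ ν : ℝ, 0 < ν → ν ≤ ν₀ →
      ∃ A : Set (ThinFilm.Torus → ℝ), A.Nonempty ∧
        ∀ h₀ ∈ A, ThinFilm.IsDatum h₀ ∧
          ThinFilm.energy ν h₀ ≤ C₂ * Real.sqrt ν ∧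
          ∀ h : ℝ → ThinFilm.Torus → ℝ, ThinFilm.IsGlobalSolution ν h₀ h →
            ∀ t : ℝ, 0 ≤ t → ThinFilm.gradSup (h t) ≤ ENNReal.ofReal B₁) := by
  refine ⟨⟨3, by norm_num, fun ν hν _ h₀ hd h hs t ht =>
    (hs.memHs_two hν hd.1 ht).gradSup_le hν (hs.energy_le hν hd.1 ht)⟩, ?_⟩
  -- The sawtooth has energy at most `3π/2 √ν + π/2 ν`, and `ν ≤ √ν₀ √ν`.
  set C₂ := 3 / 2 * Real.pi + Real.pi / 2 * √ν₀ with hC₂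
  have hπ := Real.pi_pos
  have hC₂0 : 0 < C₂ := by positivity
  refine ⟨C₂, 3 * max 1 (C₂ ^ (1 / 3 : ℝ)), hC₂0, by positivity, fun ν hν hνν₀ =>
    -- The family is the whole energy sublevel set; the sawtooth serves only to show that it is
    -- nonempty.
    ⟨{f | ThinFilm.IsDatum f ∧ ThinFilm.energy ν f ≤ C₂ * √ν}, ?_, fun h₀ hh₀ =>
      ⟨hh₀.1, hh₀.2, fun h hs t ht => ?_⟩⟩⟩
  · obtain ⟨f, hf, hfE⟩ := ThinFilm.exists_isDatum_energy_le hν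
    refine ⟨f, hf, hfE.trans ?_⟩
    have h1 : ν = √ν * √ν := (Real.mul_self_sqrt hν.le).symm
    have h2 : √ν * √ν ≤ √ν₀ * √ν := by gcongr
    have h3 := mul_le_mul_of_nonneg_left (h1.le.trans h2) (by positivity : 0 ≤ Real.pi / 2)
    rw [hC₂]
    linarith
  · refine ((hs.memHs_two hν hh₀.1.1 ht).gradSup_le hν
      ((hs.energy_le hν hh₀.1.1 ht).trans hh₀.2)).trans_eq ?_
    congr 3
    -- The powers of `ν` cancel: `ν^{-1/6} (C₂ ν^{1/2})^{1/3} = C₂^{1/3}`.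
    rw [Real.mul_rpow hC₂0.le (Real.sqrt_nonneg _), Real.sqrt_eq_rpow, ← Real.rpow_mul hν.le,
      mul_left_comm, ← Real.rpow_add hν]
    norm_num
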